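/- Let $\mathcal O=\mathbb C\{x,y\}$ and let $\mathcal W(4)$ be a nonsingular planar $4$-web of $(\mathbb C^2,0)$: its leaves are the level curves of $F_1,\dots,F_4\in\mathcal O$ with $F_i(0)=0$ and $dF_i(0)\wedge dF_j(0)\neq0$ for $i\ne j$. Suppose it is presented by $F\in\mathcal O[p]$, i.e. $F=g\prod_{i=1}^4(\partial_y(F_i)\,p+\partial_x(F_i))$ with $g\in\mathcal O^*$, and that the $p$-resultant $R$ of $F$ (and $\partial_pF$) satisfies $R(0)\ne0$; let $p_i=-\partial_x(F_i)/\partial_y(F_i)\in\mathcal O$ be the slopes. Let $P_{\mathcal W}=P_0+P_1p+P_2p^2+P_3p^3\in\mathcal O[p]$ be the polynomial of degree at most $3$ with $P_{\mathcal W}(x,y,p_i)=\partial_x(p_i)+p_i\,\partial_y(p_i)$ for $1\le i\le 4$, and put $$\begin{aligned}L_1={}&3\partial_y^2P_0-2\partial_x\partial_yP_1+\partial_x^2P_2+6P_0\partial_xP_3+3P_3\partial_xP_0-3P_0\partial_yP_2-3P_2\partial_yP_0+2P_1\partial_yP_1-P_1\partial_xP_2,\\ L_2={}&3\partial_x^2P_3-2\partial_x\partial_yP_2+\partial_y^2P_1-6P_3\partial_yP_0-3P_0\partial_yP_3+3P_3\partial_xP_1+3P_1\partial_xP_3-2P_2\partial_xP_2+P_2\partial_yP_1.\end{aligned}$$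 By polynomial identification, the form $\omega=(b_3p+b_4)\frac{dy-p\,dx}{\partial_p(F)}$ (with $b_3,b_4\in\mathcal O$) on the surface $\{F=0\}$ is closed if and only if $$\mathcal M(4)\quad\begin{cases}\partial_x(b_4)+A_{11}b_3+A_{12}b_4=0\\ \partial_x(b_3)+\partial_y(b_4)+A_{21}b_3+A_{22}b_4=0\\ \partial_y(b_3)+A_{31}b_3+A_{32}b_4=0,\end{cases}$$ where the $A_{k\ell}\in\mathcal O$ are uniquely determined. Precisely, for all $b_3,b_4\in\mathcal O$ the three left-hand sides are the coefficients of $1,p,p^2$ of the polynomial of degree at most $3$ (in fact at most $2$) which at each $p_i$ takes the value $\partial_p(F)(p_i)\,\bigl(\partial_x(c_i)+\partial_y(p_ic_i)\bigr)$, $c_i=(b_3p_i+b_4)/\partial_p(F)(p_i)$. Let $\alpha=\tfrac13(2A_{12}+A_{21})\,dx+\tfrac13(A_{22}+2A_{31})\,dy$ and write $d\alpha=\kappa\,dx\wedge dy$. Let $E\subset J_2(\mathcal O^2)$ be the bundle of rank $3$ of the $2$-jets of $(b_3,b_4)$ that satisfy $\mathcal M(4)$ and its first formal derivatives. The projection $J_2\to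 J_1$ identifies $E$ with the bundle $R_0$ of the $1$-jets that satisfy $\mathcal M(4)$. Let $\nabla:E\to\Omega^1\otimes_{\mathcal O}R_0\simeq\Omega^1\otimes_{\mathcal O} E$ be the connection induced by the Spencer operator $J_2(\mathcal O^2)\to\Omega^1\otimes J_1(\mathcal O^2)$, and let $K\,dx\wedge dy$ be its curvature. A basis of $E$ is called adapted if its first vector lies in the kernel of $E\to J_0(\mathcal O^2)$. Then: 1. There is an adapted basis of $(E,\nabla)$, namely the one in which the jet of $(b_3,b_4)$ has the coordinates $\bigl(3\,\partial_xb_3+(A_{12}+2A_{21})b_3+(A_{22}-A_{31})b_4,\ b_3,\ -b_4\bigr)$, in which the curvature matrix is $$\begin{pmatrix}k_1&k_2&k_3\\0&0&0\\0&0&0\end{pmatrix}dx\wedge dy=\begin{pmatrix}3\kappa&3\partial_x(\kappa)+L_1&3\partial_y(\kappa)+L_2\\0&0&0\\0&0&0\end{pmatrix}dx\wedge dy.$$ 2. $\mathcal W(4)$ is linearisable (some germ of biholomorphism maps all its leaves near $0$ into straight lines) if and only if $L_1=L_2=0$, that is, if and only if, in this basis, $k_2=3\partial_x(\kappa)$ and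 $k_3=3\partial_y(\kappa)$. 3. (Poincaré) Every nonsingular planar $4$-web of maximal rank is linearisable, i.e. every one for which the space of abelian relations $\{(g_1(F_1),\dots,g_4(F_4)):\ g_i\in\mathbb C\{t\},\ \sum_i g_i(F_i)\,dF_i=0\}$ has dimension $3$ over $\mathbb C$. -/

import Mathlib

open Filter Topology Polynomial

noncomputable section

namespace WebGeometry

/-! ### The ring `ℂ{x, y}` of germs of analytic functions at `0 ∈ ℂ²` and its two derivations -/

instance germAlgebra : Algebra ℂ (Germ (𝓝 (0 : ℂ × ℂ)) ℂ) :=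
  Algebra.ofModule
    (fun r a b => by
      induction a using Germ.inductionOn with | _ f =>
      induction b using Germ.inductionOn with | _ g =>
      rw [← Germ.coe_smul, ← Germ.coe_mul, ← Germ.coe_mul, ← Germ.coe_smul, smul_mul_assoc])
    (fun r a b => by
      induction a using Germ.inductionOn with | _ f =>
      induction b using Germ.inductionOn with | _ g =>
      rw [← Germ.coe_smul, ← Germ.coe_mul, ← Germ.coe_mul, ← Germ.coe_smul, mul_smul_comm])

/-- The germs at `0 ∈ ℂ²` which have an analytic representative. -/
def analyticGerms : Subalgebra ℂ (Germ (𝓝 (0 : ℂ × ℂ)) ℂ) where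
  carrier := {g | ∃ f : ℂ × ℂ → ℂ, AnalyticAt ℂ f 0 ∧ (f : Germ (𝓝 (0 : ℂ × ℂ)) ℂ) = g}
  mul_mem' := by
    rintro _ _ ⟨f, hf, rfl⟩ ⟨g, hg, rfl⟩
    exact ⟨f * g, hf.mul hg, rfl⟩
  add_mem' := by
    rintro _ _ ⟨f, hf, rfl⟩ ⟨g, hg, rfl⟩
    exact ⟨f + g, hf.add hg, rfl⟩
  algebraMap_mem' := by
    intro r
    refine ⟨r • (fun _ => (1 : ℂ)), analyticAt_const.const_smul, ?_⟩
    rw [Algebra.algebraMap_eq_smul_one]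
    rfl

/-- `𝒪 = ℂ{x, y}`. -/
def 𝒪 : Type := analyticGerms

instance : CommRing 𝒪 := inferInstanceAs (CommRing analyticGerms)

instance : Algebra ℂ 𝒪 := inferInstanceAs (Algebra ℂ analyticGerms)

/-- The underlying germ of function. -/
def 𝒪.val (g : 𝒪) : Germ (𝓝 (0 : ℂ × ℂ)) ℂ := Subtype.val g

/-- The germ of an analytic function. -/
def toGerm (f : ℂ × ℂ → ℂ) (hf : AnalyticAt ℂ f 0) : 𝒪 := ⟨(f : Germ (𝓝 (0 : ℂ × ℂ)) ℂ), f, hf, rfl⟩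

/-- The value at `0` of a germ. -/
def valueAtZero (g : 𝒪) : ℂ := g.val.value

/-- Directional derivative of a germ of function: the germ of `z ↦ f'(z) v`. -/
def germDeriv (v : ℂ × ℂ) (g : Germ (𝓝 (0 : ℂ × ℂ)) ℂ) : Germ (𝓝 (0 : ℂ × ℂ)) ℂ :=
  Quotient.map' (s₂ := germSetoid (𝓝 (0 : ℂ × ℂ)) ℂ)
    (fun (f : ℂ × ℂ → ℂ) z => fderiv ℂ f z v)
    (fun _ _ h => (EventuallyEq.fderiv h).fun_comp (fun L : ℂ × ℂ →L[ℂ] ℂ => L v)) g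

theorem germDeriv_coe (v : ℂ × ℂ) (f : ℂ × ℂ → ℂ) :
    germDeriv v (f : Germ (𝓝 (0 : ℂ × ℂ)) ℂ) =
      ((fun z => fderiv ℂ f z v : ℂ × ℂ → ℂ) : Germ (𝓝 (0 : ℂ × ℂ)) ℂ) := rfl

theorem germDeriv_mem (v : ℂ × ℂ) (g : 𝒪) :
    germDeriv v g.val ∈ analyticGerms := by
  obtain ⟨_, f, hf, rfl⟩ := g
  refine ⟨fun z => fderiv ℂ f z v, ?_, rfl⟩
  exact ((ContinuousLinearMap.apply ℂ ℂ v).analyticAt _).comp hf.fderiv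

/-- Directional derivative as a `ℂ`-derivation of `𝒪`. -/
def directionalDerivation (v : ℂ × ℂ) : Derivation ℂ 𝒪 𝒪 :=
  Derivation.mk'
    { toFun := fun g => ⟨germDeriv v g.val, germDeriv_mem v g⟩
      map_add' := by
        rintro ⟨_, f, hf, rfl⟩ ⟨_, g, hg, rfl⟩
        apply Subtype.ext
        change germDeriv v ((f + g : ℂ × ℂ → ℂ) : Germ (𝓝 (0 : ℂ × ℂ)) ℂ) =
          germDeriv v (f : Germ (𝓝 (0 : ℂ × ℂ)) ℂ) + germDeriv v (g : Germ (𝓝 (0 : ℂ × ℂ)) ℂ)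
        rw [germDeriv_coe, germDeriv_coe, germDeriv_coe, ← Germ.coe_add, Germ.coe_eq]
        filter_upwards [hf.eventually_analyticAt, hg.eventually_analyticAt] with z h1 h2
        simp [fderiv_add h1.differentiableAt h2.differentiableAt]
      map_smul' := by
        rintro r ⟨_, f, hf, rfl⟩
        apply Subtype.ext
        change germDeriv v ((r • f : ℂ × ℂ → ℂ) : Germ (𝓝 (0 : ℂ × ℂ)) ℂ) =
          r • germDeriv v (f : Germ (𝓝 (0 : ℂ × ℂ)) ℂ)
        rw [germDeriv_coe, germDeriv_coe, ← Germ.coe_smul, Germ.coe_eq]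
        filter_upwards [hf.eventually_analyticAt] with z h1
        simp [fderiv_const_smul h1.differentiableAt] }
    (by
      rintro ⟨_, f, hf, rfl⟩ ⟨_, g, hg, rfl⟩
      apply Subtype.ext
      change germDeriv v ((f * g : ℂ × ℂ → ℂ) : Germ (𝓝 (0 : ℂ × ℂ)) ℂ) =
        (f : Germ (𝓝 (0 : ℂ × ℂ)) ℂ) * germDeriv v (g : Germ (𝓝 (0 : ℂ × ℂ)) ℂ) +
        (g : Germ (𝓝 (0 : ℂ × ℂ)) ℂ) * germDeriv v (f : Germ (𝓝 (0 : ℂ × ℂ)) ℂ)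
      rw [germDeriv_coe, germDeriv_coe, germDeriv_coe, ← Germ.coe_mul, ← Germ.coe_mul,
        ← Germ.coe_add, Germ.coe_eq]
      filter_upwards [hf.eventually_analyticAt, hg.eventually_analyticAt] with z h1 h2
      simp [fderiv_mul h1.differentiableAt h2.differentiableAt])

/-- `∂/∂x` on `𝒪`. -/
def dX : Derivation ℂ 𝒪 𝒪 := directionalDerivation (1, 0)

/-- `∂/∂y` on `𝒪`. -/
def dY : Derivation ℂ 𝒪 𝒪 := directionalDerivation (0, 1)

/-! ### Nonsingular planar webs -/

/-- A nonsingular `d`-web of `(ℂ², 0)`: the leaves of the `i`-th foliation are the level curves of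
`f i`, and the foliations are in general position. -/
structure PlanarWeb (d : ℕ) where
  f : Fin d → ℂ × ℂ → ℂ
  analyticAt : ∀ i, AnalyticAt ℂ (f i) 0
  map_zero : ∀ i, f i 0 = 0
  generalPosition : ∀ i j, i ≠ j →
    fderiv ℂ (f i) 0 (1, 0) * fderiv ℂ (f j) 0 (0, 1) -
      fderiv ℂ (f i) 0 (0, 1) * fderiv ℂ (f j) 0 (1, 0) ≠ 0

namespace PlanarWeb

variable {d : ℕ} (W : PlanarWeb d)

/-- The first integral `F_i` as an element of `𝒪`. -/
def germ (i : Fin d) : 𝒪 := toGerm (W.f i) (W.analyticAt i)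

/-- The web is linearisable: some germ of biholomorphism `φ` maps all the leaves near `0`
onto germs of straight lines. -/
def Linearisable : Prop :=
  ∃ φ : ℂ × ℂ → ℂ × ℂ, AnalyticAt ℂ φ 0 ∧ Function.Bijective (fderiv ℂ φ 0) ∧
    ∃ U ∈ 𝓝 (0 : ℂ × ℂ), ∀ i, ∀ z ∈ U, Collinear ℂ (φ '' {z' ∈ U | W.f i z' = W.f i z})

/-- The space of abelian relations: the tuples `(g_1(F_1), …, g_d(F_d))` with `g_i ∈ ℂ{t}` and
`∑ g_i(F_i) dF_i = 0`. -/
def abelianRelations : Submodule ℂ (Fin d → 𝒪) where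
  carrier := {h | (∀ i, ∃ g : ℂ → ℂ, AnalyticAt ℂ g 0 ∧
      (h i).val = ((g ∘ W.f i : ℂ × ℂ → ℂ) : Germ (𝓝 (0 : ℂ × ℂ)) ℂ)) ∧
    ∑ i, h i * dX (W.germ i) = 0 ∧ ∑ i, h i * dY (W.germ i) = 0}
  zero_mem' := by
    refine ⟨fun i => ⟨0, analyticAt_const, rfl⟩, ?_, ?_⟩ <;> simp
  add_mem' := by
    rintro a b ⟨ha, ha1, ha2⟩ ⟨hb, hb1, hb2⟩
    refine ⟨fun i => ?_, ?_, ?_⟩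
    · obtain ⟨g, hg, e⟩ := ha i
      obtain ⟨g', hg', e'⟩ := hb i
      refine ⟨g + g', hg.add hg', ?_⟩
      change (a i).val + (b i).val = _
      rw [e, e']
      rfl
    · simp [add_mul, Finset.sum_add_distrib, ha1, hb1]
    · simp [add_mul, Finset.sum_add_distrib, ha2, hb2]
  smul_mem' := by
    rintro c a ⟨ha, ha1, ha2⟩
    refine ⟨fun i => ?_, ?_, ?_⟩
    · obtain ⟨g, hg, e⟩ := ha i
      refine ⟨c • g, hg.const_smul, ?_⟩
      change c • (a i).val = _
      rw [e]
      rfl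
    · simp [← Finset.smul_sum, ha1]
    · simp [← Finset.smul_sum, ha2]

/-- The rank of the web. -/
def rank : ℕ := Module.finrank ℂ W.abelianRelations

/-- `F(x, y, y') = 0` presents the web: up to a unit of `𝒪`,
`F = ∏ (∂_y(F_i) p + ∂_x(F_i))`, and the `p`-resultant `R` of `F` satisfies `R(0) ≠ 0`. -/
def Presents (W : PlanarWeb d) (F : 𝒪[X]) : Prop :=
  (∃ g : 𝒪ˣ, F = C (g : 𝒪) * ∏ i, (C (dY (W.germ i)) * X + C (dX (W.germ i)))) ∧
    valueAtZero (F.resultant (derivative F) d (d - 1)) ≠ 0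

/-- The slope `p_i = - ∂_x(F_i) / ∂_y(F_i)` of the leaves of the `i`-th foliation. -/
def slope (i : Fin d) : 𝒪 := -dX (W.germ i) * Ring.inverse (dY (W.germ i))

/-- The coefficients (in increasing order) of the unique polynomial of degree at most `d - 1`
taking the value `v i` at each slope `p_i`. -/
def interpolate (v : Fin d → 𝒪) : Fin d → 𝒪 :=
  Matrix.mulVec (Matrix.vandermonde W.slope)⁻¹ v

/-- The coefficients (in increasing order) of the polynomial `P_W` of degree at most `d - 1` with
`P_W(x, y, p_i) = ∂_x(p_i) + p_i ∂_y(p_i)` for all `i`. -/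
def polyP : Fin d → 𝒪 :=
  W.interpolate fun i => dX (W.slope i) + W.slope i * dY (W.slope i)

end PlanarWeb

/-! ### The differential system `M(4)` of a 4-web -/

/-- On the `i`-th sheet of `F = 0` the form `ω = (b₃ p + b₄) (dy - p dx) / ∂_p(F)` is
`c dy - c p_i dx`, with `c = (b₃ p_i + b₄) / ∂_p(F)(p_i)`, so that
`dω = (∂_x(c) + ∂_y(p_i c)) dx ∧ dy`. This is the coefficient of `dω`, times `∂_p(F)(p_i)`. -/
def closedness (W : PlanarWeb 4) (F : 𝒪[X]) (b₃ b₄ : 𝒪) (i : Fin 4) : 𝒪 :=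
  let Fp := (derivative F).eval (W.slope i)
  let c := (b₃ * W.slope i + b₄) * Ring.inverse Fp
  Fp * (dX c + dY (W.slope i * c))

/-- The coefficients `A_{k,l}` of the system `M(4)`
```
  ∂_x(b₄)            + A₁₁ b₃ + A₁₂ b₄ = 0
  ∂_x(b₃) + ∂_y(b₄)  + A₂₁ b₃ + A₂₂ b₄ = 0
  ∂_y(b₃)            + A₃₁ b₃ + A₃₂ b₄ = 0
```
obtained by polynomial identification in `dω = 0`: the three left-hand sides are the coefficients
of `1, p, p²` in the polynomial of degree at most `3` which takes the values `closedness` at the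
slopes (its coefficient of `p³` vanishes identically, because the trace of `ω` does). The terms of
order zero are therefore read off at `(b₃, b₄) = (1, 0)` and `(0, 1)`. -/
def systemM (W : PlanarWeb 4) (F : 𝒪[X]) : Matrix (Fin 3) (Fin 2) 𝒪 := fun k l =>
  W.interpolate (closedness W F (if l = 0 then 1 else 0) (if l = 1 then 1 else 0)) k.castSucc

/-! ### Jets, prolongation, and the connection of a system `M(4)`

A section of the bundle `J_k(𝒪²)` of `k`-jets of pairs `(b₃, b₄)` is a family `u j (a, b)` with
`j = 0, 1` and `a + b ≤ k`; the entry `u j (a, b)` is the slot of `∂_x^a ∂_y^b` of `b₃` (`j = 0`),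
resp. of `b₄` (`j = 1`). -/

abbrev Jet (k : ℕ) : Type := Fin 2 → {α : ℕ × ℕ // α.1 + α.2 ≤ k} → 𝒪

/-- The projection `J_{k+1} → J_k`. -/
def proj (k : ℕ) : Jet (k + 1) →ₗ[𝒪] Jet k where
  toFun u := fun j α => u j ⟨α.1, by have := α.2; omega⟩
  map_add' _ _ := rfl
  map_smul' _ _ := rfl

/-- The jet of formal `x`-derivatives. -/
def shiftX (k : ℕ) : Jet (k + 1) →ₗ[𝒪] Jet k where
  toFun u := fun j α => u j ⟨(α.1.1 + 1, α.1.2), by have := α.2; dsimp only; omega⟩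
  map_add' _ _ := rfl
  map_smul' _ _ := rfl

/-- The jet of formal `y`-derivatives. -/
def shiftY (k : ℕ) : Jet (k + 1) →ₗ[𝒪] Jet k where
  toFun u := fun j α => u j ⟨(α.1.1, α.1.2 + 1), by have := α.2; dsimp only; omega⟩
  map_add' _ _ := rfl
  map_smul' _ _ := rfl

/-- A derivation of `𝒪` acting on the components of a jet. -/
def onJet (D : Derivation ℂ 𝒪 𝒪) (k : ℕ) (u : Jet k) : Jet k := fun j α => D (u j α)

/-- The `dx`-component of the Spencer operator `J_{k+1} → Ω¹ ⊗ J_k`. -/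
def spencerX (k : ℕ) (u : Jet (k + 1)) : Jet k := onJet dX k (proj k u) - shiftX k u

/-- The `dy`-component of the Spencer operator `J_{k+1} → Ω¹ ⊗ J_k`. -/
def spencerY (k : ℕ) (u : Jet (k + 1)) : Jet k := onJet dY k (proj k u) - shiftY k u

/-- The values `(b₃, b₄)` of a jet. -/
def values (k : ℕ) : Jet k →ₗ[𝒪] (Fin 2 → 𝒪) where
  toFun u := fun j => u j ⟨(0, 0), Nat.zero_le _⟩
  map_add' _ _ := rfl
  map_smul' _ _ := rfl

/-- The principal part of the system `M(4)`, on `1`-jets. -/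
def symbolM : Jet 1 →ₗ[𝒪] (Fin 3 → 𝒪) where
  toFun u :=
    ![u 1 ⟨(1, 0), le_rfl⟩, u 0 ⟨(1, 0), le_rfl⟩ + u 1 ⟨(0, 1), le_rfl⟩, u 0 ⟨(0, 1), le_rfl⟩]
  map_add' u v := by
    funext k
    fin_cases k
    · rfl
    · exact add_add_add_comm _ _ _ _
    · rfl
  map_smul' c u := by
    funext k
    fin_cases k
    · rfl
    · exact (mul_add c (u 0 ⟨(1, 0), le_rfl⟩) (u 1 ⟨(0, 1), le_rfl⟩)).symm
    · rfl

/-- The left-hand sides of the system `M(4)` with coefficients `A`, on `1`-jets. -/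
def opM (A : Matrix (Fin 3) (Fin 2) 𝒪) : Jet 1 →ₗ[𝒪] (Fin 3 → 𝒪) :=
  symbolM + A.mulVecLin ∘ₗ values 1

/-- `R_0 ⊆ J_1(𝒪²)`: the `1`-jets which satisfy the system. -/
def bundleR (A : Matrix (Fin 3) (Fin 2) 𝒪) : Submodule 𝒪 (Jet 1) := LinearMap.ker (opM A)

/-- The formal derivative along `x` of the left-hand sides of the system, on `2`-jets. -/
def opMX (A : Matrix (Fin 3) (Fin 2) 𝒪) : Jet 2 →ₗ[𝒪] (Fin 3 → 𝒪) :=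
  opM A ∘ₗ shiftX 1 + (A.map dX).mulVecLin ∘ₗ values 2

/-- The formal derivative along `y` of the left-hand sides of the system, on `2`-jets. -/
def opMY (A : Matrix (Fin 3) (Fin 2) 𝒪) : Jet 2 →ₗ[𝒪] (Fin 3 → 𝒪) :=
  opM A ∘ₗ shiftY 1 + (A.map dY).mulVecLin ∘ₗ values 2

/-- The bundle `E ⊆ J_2(𝒪²)`: the first prolongation of the system, i.e. the `2`-jets which satisfy
the system and its two formal derivatives. -/
def bundleE (A : Matrix (Fin 3) (Fin 2) 𝒪) : Submodule 𝒪 (Jet 2) :=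
  LinearMap.ker (opM A ∘ₗ proj 1) ⊓ LinearMap.ker (opMX A) ⊓ LinearMap.ker (opMY A)

variable (A : Matrix (Fin 3) (Fin 2) 𝒪)

theorem mem_bundleE {u : Jet 2} :
    u ∈ bundleE A ↔ opM A (proj 1 u) = 0 ∧ opMX A u = 0 ∧ opMY A u = 0 := by
  simp only [bundleE, Submodule.mem_inf, LinearMap.mem_ker, LinearMap.comp_apply, and_assoc]

/-- The projection `J_2 → J_1` restricted to `E → R_0`. -/
def projE : bundleE A →ₗ[𝒪] bundleR A :=
  (proj 1).restrict fun _ hu => ((mem_bundleE A).1 hu).1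

/-- The second-order entries of an element of `E` in terms of its `1`-jet. -/
def liftJet (v : Jet 1) : Jet 2 :=
  let lx : Fin 3 → 𝒪 := A.mulVec (fun j => v j ⟨(1, 0), le_rfl⟩) + (A.map dX).mulVec (values 1 v)
  let ly : Fin 3 → 𝒪 := A.mulVec (fun j => v j ⟨(0, 1), le_rfl⟩) + (A.map dY).mulVec (values 1 v)
  fun j α =>
    if h : α.1.1 + α.1.2 ≤ 1 then v j ⟨α.1, h⟩
    else if α.1.1 = 2 then ![ly 0 - lx 1, -lx 0] j
    else if α.1.1 = 1 then ![-lx 2, -ly 0] j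
    else ![-ly 2, lx 2 - ly 1] j

theorem proj_liftJet (v : Jet 1) : proj 1 (liftJet A v) = v := by
  funext j α
  have h := α.2
  simp [proj, liftJet, h]

theorem opMX_apply (u : Jet 2) : opMX A u = symbolM (shiftX 1 u) +
    (A.mulVec (fun j => u j ⟨(1, 0), one_le_two⟩) + (A.map dX).mulVec (values 2 u)) :=
  add_assoc _ _ _

theorem opMY_apply (u : Jet 2) : opMY A u = symbolM (shiftY 1 u) +
    (A.mulVec (fun j => u j ⟨(0, 1), one_le_two⟩) + (A.map dY).mulVec (values 2 u)) :=
  add_assoc _ _ _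

theorem liftJet_mem (v : Jet 1) (hv : v ∈ bundleR A) : liftJet A v ∈ bundleE A := by
  rw [mem_bundleE, proj_liftJet, opMX_apply, opMY_apply]
  have hx : (A.mulVec (fun j => liftJet A v j ⟨(1, 0), one_le_two⟩) +
      (A.map dX).mulVec (values 2 (liftJet A v))) =
      A.mulVec (fun j => v j ⟨(1, 0), le_rfl⟩) + (A.map dX).mulVec (values 1 v) := rfl
  have hy : (A.mulVec (fun j => liftJet A v j ⟨(0, 1), one_le_two⟩) +
      (A.map dY).mulVec (values 2 (liftJet A v))) =
      A.mulVec (fun j => v j ⟨(0, 1), le_rfl⟩) + (A.map dY).mulVec (values 1 v) := rfl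
  rw [hx, hy]
  refine ⟨hv, ?_, ?_⟩
  · funext k
    fin_cases k
    · exact neg_add_cancel _
    · exact (by intro a b; ring : ∀ a b : 𝒪, (a - b + -a) + b = 0) _ _
    · exact neg_add_cancel _
  · funext k
    fin_cases k
    · exact neg_add_cancel _
    · exact (by intro a b; ring : ∀ a b : 𝒪, (-a + (a - b)) + b = 0) _ _
    · exact neg_add_cancel _

theorem projE_injective : Function.Injective (projE A) := by
  refine (injective_iff_map_eq_zero (projE A)).2 ?_
  rintro ⟨u, hu⟩ h0
  have h1 : proj 1 u = 0 := congrArg Subtype.val h0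
  obtain ⟨-, hx, hy⟩ := (mem_bundleE A).1 hu
  have hv : values 2 u = 0 := by
    funext j
    exact congrFun (congrFun h1 j) ⟨(0, 0), Nat.zero_le _⟩
  have hu1 : (fun j => u j ⟨(1, 0), one_le_two⟩) = 0 := by
    funext j
    exact congrFun (congrFun h1 j) ⟨(1, 0), le_rfl⟩
  have hu2 : (fun j => u j ⟨(0, 1), one_le_two⟩) = 0 := by
    funext j
    exact congrFun (congrFun h1 j) ⟨(0, 1), le_rfl⟩
  rw [opMX_apply, hv, hu1, Matrix.mulVec_zero, Matrix.mulVec_zero, add_zero, add_zero] at hx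
  rw [opMY_apply, hv, hu2, Matrix.mulVec_zero, Matrix.mulVec_zero, add_zero, add_zero] at hy
  have x0 : u 1 ⟨(2, 0), le_rfl⟩ = 0 := congrFun hx 0
  have x1 : u 0 ⟨(2, 0), le_rfl⟩ + u 1 ⟨(1, 1), le_rfl⟩ = 0 := congrFun hx 1
  have x2 : u 0 ⟨(1, 1), le_rfl⟩ = 0 := congrFun hx 2
  have y0 : u 1 ⟨(1, 1), le_rfl⟩ = 0 := congrFun hy 0
  have y1 : u 0 ⟨(1, 1), le_rfl⟩ + u 1 ⟨(0, 2), le_rfl⟩ = 0 := congrFun hy 1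
  have y2 : u 0 ⟨(0, 2), le_rfl⟩ = 0 := congrFun hy 2
  rw [y0, add_zero] at x1
  rw [x2, zero_add] at y1
  apply Subtype.ext
  funext j α
  by_cases hα : α.1.1 + α.1.2 ≤ 1
  · exact congrFun (congrFun h1 j) ⟨α.1, hα⟩
  · obtain ⟨⟨a, b⟩, h⟩ := α
    dsimp only at h hα
    obtain ⟨rfl, rfl⟩ | ⟨rfl, rfl⟩ | ⟨rfl, rfl⟩ :
        (a = 2 ∧ b = 0) ∨ (a = 1 ∧ b = 1) ∨ (a = 0 ∧ b = 2) := by omega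
    all_goals fin_cases j <;> assumption

/-- The projection `E → R_0` is an isomorphism. -/
def projEquiv : bundleE A ≃ₗ[𝒪] bundleR A :=
  LinearEquiv.ofBijective (projE A)
    ⟨projE_injective A, fun v => ⟨⟨liftJet A v, liftJet_mem A v v.2⟩,
      Subtype.ext (proj_liftJet A v)⟩⟩

theorem opM_onJet (D : Derivation ℂ 𝒪 𝒪) (v : Jet 1) :
    opM A (onJet D 1 v) + (A.map D).mulVec (values 1 v) = fun k => D (opM A v k) := by
  funext k
  have h : D (A.mulVec (values 1 v) k) =
      A.mulVec (values 1 (onJet D 1 v)) k + (A.map D).mulVec (values 1 v) k := by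
    simp only [Matrix.mulVec, dotProduct, map_sum, Derivation.leibniz, Finset.sum_add_distrib,
      smul_eq_mul, Matrix.map_apply]
    congr 1
    exact Finset.sum_congr rfl fun j _ => mul_comm _ _
  have h' : D (symbolM v k) = symbolM (onJet D 1 v) k := by
    fin_cases k
    · rfl
    · exact map_add D _ _
    · rfl
  change symbolM (onJet D 1 v) k + A.mulVec (values 1 (onJet D 1 v)) k +
    (A.map D).mulVec (values 1 v) k = D (symbolM v k + A.mulVec (values 1 v) k)
  rw [map_add, h, h', add_assoc]

theorem spencerX_mem (u : Jet 2) (hu : u ∈ bundleE A) : spencerX 1 u ∈ bundleR A := by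
  obtain ⟨h0, hx, -⟩ := (mem_bundleE A).1 hu
  have h := opM_onJet A dX (proj 1 u)
  have hx' : opM A (shiftX 1 u) + (A.map dX).mulVec (values 1 (proj 1 u)) = 0 := hx
  have h0' : (fun k => dX (opM A (proj 1 u) k)) = (0 : Fin 3 → 𝒪) := by
    rw [h0]
    funext k
    exact map_zero dX
  rw [h0', ← hx'] at h
  rw [bundleR, LinearMap.mem_ker, spencerX, map_sub, add_right_cancel h, sub_self]

theorem spencerY_mem (u : Jet 2) (hu : u ∈ bundleE A) : spencerY 1 u ∈ bundleR A := by
  obtain ⟨h0, -, hy⟩ := (mem_bundleE A).1 hu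
  have h := opM_onJet A dY (proj 1 u)
  have hy' : opM A (shiftY 1 u) + (A.map dY).mulVec (values 1 (proj 1 u)) = 0 := hy
  have h0' : (fun k => dY (opM A (proj 1 u) k)) = (0 : Fin 3 → 𝒪) := by
    rw [h0]
    funext k
    exact map_zero dY
  rw [h0', ← hy'] at h
  rw [bundleR, LinearMap.mem_ker, spencerY, map_sub, add_right_cancel h, sub_self]

/-- The connection `∇ = dx ⊗ ∇_x + dy ⊗ ∇_y` of `E`: the Spencer operator `E → Ω¹ ⊗ R_0` followed by
the inverse of the isomorphism `E ≃ R_0`. This is `∇_x`. -/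
def nablaX (u : bundleE A) : bundleE A :=
  (projEquiv A).symm ⟨spencerX 1 u, spencerX_mem A u u.2⟩

/-- The `dy`-component `∇_y` of the connection. -/
def nablaY (u : bundleE A) : bundleE A :=
  (projEquiv A).symm ⟨spencerY 1 u, spencerY_mem A u u.2⟩

theorem onJet_smul (D : Derivation ℂ 𝒪 𝒪) (k : ℕ) (c : 𝒪) (u : Jet k) :
    onJet D k (c • u) = c • onJet D k u + D c • u := by
  funext j α
  change D (c * u j α) = c * D (u j α) + D c * u j α
  rw [Derivation.leibniz, smul_eq_mul, smul_eq_mul, mul_comm (u j α)]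

theorem onJet_add (D : Derivation ℂ 𝒪 𝒪) (k : ℕ) (u v : Jet k) :
    onJet D k (u + v) = onJet D k u + onJet D k v := by
  funext j α
  exact map_add D _ _

theorem nablaX_add (u v : bundleE A) : nablaX A (u + v) = nablaX A u + nablaX A v := by
  rw [nablaX, nablaX, nablaX, ← map_add]
  congr 1
  apply Subtype.ext
  change spencerX 1 ((u : Jet 2) + v) = spencerX 1 u + spencerX 1 v
  rw [spencerX, spencerX, spencerX, map_add, map_add, onJet_add]
  abel

theorem nablaY_add (u v : bundleE A) : nablaY A (u + v) = nablaY A u + nablaY A v := by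
  rw [nablaY, nablaY, nablaY, ← map_add]
  congr 1
  apply Subtype.ext
  change spencerY 1 ((u : Jet 2) + v) = spencerY 1 u + spencerY 1 v
  rw [spencerY, spencerY, spencerY, map_add, map_add, onJet_add]
  abel

theorem nablaX_smul (c : 𝒪) (u : bundleE A) : nablaX A (c • u) = c • nablaX A u + dX c • u := by
  apply (projEquiv A).injective
  rw [map_add, map_smul, map_smul, nablaX, nablaX, LinearEquiv.apply_symm_apply,
    LinearEquiv.apply_symm_apply]
  apply Subtype.ext
  change spencerX 1 (c • (u : Jet 2)) = c • spencerX 1 u + dX c • proj 1 u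
  rw [spencerX, spencerX, map_smul, map_smul, onJet_smul, smul_sub]
  abel

theorem nablaY_smul (c : 𝒪) (u : bundleE A) : nablaY A (c • u) = c • nablaY A u + dY c • u := by
  apply (projEquiv A).injective
  rw [map_add, map_smul, map_smul, nablaY, nablaY, LinearEquiv.apply_symm_apply,
    LinearEquiv.apply_symm_apply]
  apply Subtype.ext
  change spencerY 1 (c • (u : Jet 2)) = c • spencerY 1 u + dY c • proj 1 u
  rw [spencerY, spencerY, map_smul, map_smul, onJet_smul, smul_sub]
  abel

/-- The two partial derivatives commute. -/
theorem dX_dY_comm (g : 𝒪) : dX (dY g) = dY (dX g) := by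
  obtain ⟨_, f, hf, rfl⟩ := g
  apply Subtype.ext
  change germDeriv (1, 0) (germDeriv (0, 1) (f : Germ (𝓝 (0 : ℂ × ℂ)) ℂ)) =
    germDeriv (0, 1) (germDeriv (1, 0) (f : Germ (𝓝 (0 : ℂ × ℂ)) ℂ))
  rw [germDeriv_coe, germDeriv_coe, germDeriv_coe, germDeriv_coe, Germ.coe_eq]
  filter_upwards [hf.eventually_analyticAt] with z hz
  have hd : DifferentiableAt ℂ (fderiv ℂ f) z := hz.fderiv.differentiableAt
  have hs : IsSymmSndFDerivAt ℂ f z :=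
    hz.contDiffAt.isSymmSndFDerivAt (n := 2) (by simp)
  rw [fderiv_clm_apply hd (differentiableAt_const _), fderiv_clm_apply hd (differentiableAt_const _)]
  simpa using hs.eq (1, 0) (0, 1)

/-- The curvature of `(E, ∇)`: `∇² = K dx ∧ dy` with `K = ∇_x ∇_y - ∇_y ∇_x`, an `𝒪`-linear
endomorphism of `E`. -/
def curvature : bundleE A →ₗ[𝒪] bundleE A where
  toFun u := nablaX A (nablaY A u) - nablaY A (nablaX A u)
  map_add' u v := by
    rw [nablaX_add, nablaY_add, nablaX_add, nablaY_add]
    abel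
  map_smul' c u := by
    rw [nablaX_smul, nablaY_smul, nablaX_add, nablaY_add, nablaX_smul, nablaY_smul, nablaX_smul,
      nablaY_smul, dX_dY_comm, RingHom.id_apply, smul_sub]
    abel

/-- A basis of `E` is adapted if it is compatible with the filtration of `E` by the order of jets:
its first vector lies in (hence spans) the kernel of `E → J_0(𝒪²)`, a line bundle. -/
def IsAdapted (B : Module.Basis (Fin 3) 𝒪 (bundleE A)) : Prop :=
  values 2 (B 0 : Jet 2) = 0

/-! ### The invariant `κ` and the linearisability conditions -/

/-- The Pfaff form `α = α_x dx + α_y dy` of the system. With `P_W = P₀ + P₁ p + P₂ p² + P₃ p³` one has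
`A₁₁ = P₀`, `A₁₂ = α_x - P₁/3`, `A₂₁ = α_x + 2 P₁/3`, `A₂₂ = α_y - 2 P₂/3`, `A₃₁ = α_y + P₂/3`,
`A₃₂ = - P₃`. This is `α_x`. -/
def pfaffX : 𝒪 := (3⁻¹ : ℂ) • (2 * A 0 1 + A 1 0)

/-- The coefficient `α_y` of the Pfaff form. -/
def pfaffY : 𝒪 := (3⁻¹ : ℂ) • (A 1 1 + 2 * A 2 0)

/-- `dα = κ dx ∧ dy`. -/
def kappa : 𝒪 := dX (pfaffY A) - dY (pfaffX A)

/-- First linearisability condition of `y'' = P₀ + P₁ y' + P₂ y'² + P₃ y'³`. -/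
def condL₁ (P : Fin 4 → 𝒪) : 𝒪 :=
  3 * dY (dY (P 0)) - 2 * dX (dY (P 1)) + dX (dX (P 2))
    + 6 * P 0 * dX (P 3) + 3 * P 3 * dX (P 0)
    - 3 * P 0 * dY (P 2) - 3 * P 2 * dY (P 0)
    + 2 * P 1 * dY (P 1) - P 1 * dX (P 2)

/-- Second linearisability condition of `y'' = P₀ + P₁ y' + P₂ y'² + P₃ y'³`. -/
def condL₂ (P : Fin 4 → 𝒪) : 𝒪 :=
  3 * dX (dX (P 3)) - 2 * dX (dY (P 2)) + dY (dY (P 1))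
    - 6 * P 3 * dY (P 0) - 3 * P 0 * dY (P 3)
    + 3 * P 3 * dX (P 1) + 3 * P 1 * dX (P 3)
    - 2 * P 2 * dX (P 2) + P 2 * dY (P 1)

end WebGeometry

end

open WebGeometry

noncomputable section

open scoped ContDiff

namespace WebGeometry

/-! ### Germs -/

theorem exists_toGerm_eq (g : 𝒪) : ∃ f, ∃ hf : AnalyticAt ℂ f 0, toGerm f hf = g := by
  obtain ⟨_, f, hf, rfl⟩ := g
  exact ⟨f, hf, rfl⟩

theorem toGerm_eq_iff {f g : ℂ × ℂ → ℂ} {hf : AnalyticAt ℂ f 0} {hg : AnalyticAt ℂ g 0} :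
    toGerm f hf = toGerm g hg ↔ f =ᶠ[𝓝 0] g := by
  rw [← Germ.coe_eq]
  exact Subtype.ext_iff

theorem toGerm_mul {f g : ℂ × ℂ → ℂ} (hf : AnalyticAt ℂ f 0) (hg : AnalyticAt ℂ g 0) :
    toGerm f hf * toGerm g hg = toGerm (f * g) (hf.mul hg) := rfl

theorem toGerm_add {f g : ℂ × ℂ → ℂ} (hf : AnalyticAt ℂ f 0) (hg : AnalyticAt ℂ g 0) :
    toGerm f hf + toGerm g hg = toGerm (f + g) (hf.add hg) := rfl

theorem toGerm_sub {f g : ℂ × ℂ → ℂ} (hf : AnalyticAt ℂ f 0) (hg : AnalyticAt ℂ g 0) :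
    toGerm f hf - toGerm g hg = toGerm (f - g) (hf.sub hg) := rfl

theorem analyticAt_fderiv_apply {f : ℂ × ℂ → ℂ} {z₀ : ℂ × ℂ} (hf : AnalyticAt ℂ f z₀) (v : ℂ × ℂ) :
    AnalyticAt ℂ (fun z => fderiv ℂ f z v) z₀ :=
  ((ContinuousLinearMap.apply ℂ ℂ v).analyticAt _).comp hf.fderiv

theorem dX_toGerm {f : ℂ × ℂ → ℂ} (hf : AnalyticAt ℂ f 0) :
    dX (toGerm f hf) = toGerm (fun z => fderiv ℂ f z (1, 0)) (analyticAt_fderiv_apply hf _) := rfl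

theorem dY_toGerm {f : ℂ × ℂ → ℂ} (hf : AnalyticAt ℂ f 0) :
    dY (toGerm f hf) = toGerm (fun z => fderiv ℂ f z (0, 1)) (analyticAt_fderiv_apply hf _) := rfl

/-- Evaluation at the origin as a ring homomorphism. -/
def evalZero : 𝒪 →+* ℂ where
  toFun := valueAtZero
  map_one' := rfl
  map_zero' := rfl
  map_add' a b := by
    obtain ⟨f, hf, rfl⟩ := exists_toGerm_eq a
    obtain ⟨g, hg, rfl⟩ := exists_toGerm_eq b
    rfl
  map_mul' a b := by
    obtain ⟨f, hf, rfl⟩ := exists_toGerm_eq a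
    obtain ⟨g, hg, rfl⟩ := exists_toGerm_eq b
    rfl

theorem evalZero_apply (g : 𝒪) : evalZero g = valueAtZero g := rfl

theorem evalZero_toGerm {f : ℂ × ℂ → ℂ} (hf : AnalyticAt ℂ f 0) :
    evalZero (toGerm f hf) = f 0 := rfl

theorem evalZero_smul (c : ℂ) (g : 𝒪) : evalZero (c • g) = c * evalZero g := by
  obtain ⟨f, hf, rfl⟩ := exists_toGerm_eq g
  rfl

theorem isUnit_of_evalZero_ne_zero {g : 𝒪} (h : evalZero g ≠ 0) : IsUnit g := by
  obtain ⟨f, hf, rfl⟩ := exists_toGerm_eq g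
  rw [evalZero_toGerm] at h
  refine IsUnit.of_mul_eq_one (toGerm f⁻¹ (hf.inv h)) ?_
  rw [toGerm_mul]
  refine Subtype.ext (Germ.coe_eq.2 ?_)
  filter_upwards [hf.continuousAt.eventually_ne h] with z hz
  exact mul_inv_cancel₀ hz

theorem evalZero_ne_zero_of_isUnit {g : 𝒪} (h : IsUnit g) : evalZero g ≠ 0 :=
  (h.map evalZero).ne_zero

theorem derivation_of_mul_eq_one (D : Derivation ℂ 𝒪 𝒪) {a b : 𝒪} (h : a * b = 1) :
    D b = -(b * b * D a) := by
  have h1 : D (a * b) = 0 := by rw [h, D.map_one_eq_zero]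
  rw [D.leibniz, smul_eq_mul, smul_eq_mul] at h1
  linear_combination b * h1 - D b * h

theorem derivation_mul (D : Derivation ℂ 𝒪 𝒪) (a b : 𝒪) : D (a * b) = a * D b + b * D a :=
  D.leibniz a b

theorem derivation_natCast_mul (D : Derivation ℂ 𝒪 𝒪) (n : ℕ) (a : 𝒪) :
    D ((n : 𝒪) * a) = n * D a := by
  rw [derivation_mul, D.map_natCast, mul_zero, add_zero]

theorem derivation_two (D : Derivation ℂ 𝒪 𝒪) : D 2 = 0 := D.map_natCast 2

theorem derivation_two_mul (D : Derivation ℂ 𝒪 𝒪) (a : 𝒪) : D (2 * a) = 2 * D a := by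
  exact_mod_cast derivation_natCast_mul D 2 a

theorem derivation_three_mul (D : Derivation ℂ 𝒪 𝒪) (a : 𝒪) : D (3 * a) = 3 * D a := by
  exact_mod_cast derivation_natCast_mul D 3 a

theorem three_mul_third_smul (a : 𝒪) : 3 * ((3⁻¹ : ℂ) • a) = a := by
  have h : (3 : 𝒪) * ((3⁻¹ : ℂ) • a) = (3 : ℂ) • ((3⁻¹ : ℂ) • a) := by
    rw [Algebra.smul_def (3 : ℂ), map_ofNat]
  rw [h, smul_smul, mul_inv_cancel₀ three_ne_zero, one_smul]

theorem isUnit_three : IsUnit (3 : 𝒪) :=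
  IsUnit.of_mul_eq_one _ (three_mul_third_smul 1)

/-! ### The bundle `E` in coordinates -/

/-- The cubic polynomial attached to a system `M(4)`. -/
def cubicOf (A : Matrix (Fin 3) (Fin 2) 𝒪) : Fin 4 → 𝒪 :=
  ![A 0 0, A 1 0 - A 0 1, A 2 0 - A 1 1, -A 2 1]

section

variable (A : Matrix (Fin 3) (Fin 2) 𝒪)

theorem three_mul_kappa :
    3 * kappa A = dX (A 1 1) + 2 * dX (A 2 0) - 2 * dY (A 0 1) - dY (A 1 0) := by
  rw [kappa, pfaffX, pfaffY, Derivation.map_smul, Derivation.map_smul, mul_sub, three_mul_third_smul,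
    three_mul_third_smul, map_add, map_add, derivation_two_mul, derivation_two_mul]
  ring

theorem mem_bundleR_iff {v : Jet 1} : v ∈ bundleR A ↔
    v 1 ⟨(1, 0), le_rfl⟩ + (A 0 0 * v 0 ⟨(0, 0), zero_le_one⟩ + A 0 1 * v 1 ⟨(0, 0), zero_le_one⟩) = 0 ∧
    v 0 ⟨(1, 0), le_rfl⟩ + v 1 ⟨(0, 1), le_rfl⟩ +
      (A 1 0 * v 0 ⟨(0, 0), zero_le_one⟩ + A 1 1 * v 1 ⟨(0, 0), zero_le_one⟩) = 0 ∧
    v 0 ⟨(0, 1), le_rfl⟩ +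
      (A 2 0 * v 0 ⟨(0, 0), zero_le_one⟩ + A 2 1 * v 1 ⟨(0, 0), zero_le_one⟩) = 0 := by
  rw [bundleR, LinearMap.mem_ker, funext_iff, Fin.forall_fin_succ, Fin.forall_fin_succ,
    Fin.forall_fin_one]
  simp only [opM, symbolM, values, LinearMap.add_apply, LinearMap.comp_apply, LinearMap.coe_mk,
    AddHom.coe_mk, Matrix.mulVecLin_apply, Pi.add_apply, Matrix.mulVec, dotProduct,
    Fin.sum_univ_two]
  rfl

theorem bundleE_second_order {u : Jet 2} (hu : u ∈ bundleE A) :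
    u 0 ⟨(1, 1), le_rfl⟩ + (A 2 0 * u 0 ⟨(1, 0), one_le_two⟩ + A 2 1 * u 1 ⟨(1, 0), one_le_two⟩ +
      (dX (A 2 0) * u 0 ⟨(0, 0), zero_le_two⟩ + dX (A 2 1) * u 1 ⟨(0, 0), zero_le_two⟩)) = 0 ∧
    u 0 ⟨(2, 0), le_rfl⟩ + u 1 ⟨(1, 1), le_rfl⟩ +
      (A 1 0 * u 0 ⟨(1, 0), one_le_two⟩ + A 1 1 * u 1 ⟨(1, 0), one_le_two⟩ +
      (dX (A 1 0) * u 0 ⟨(0, 0), zero_le_two⟩ + dX (A 1 1) * u 1 ⟨(0, 0), zero_le_two⟩)) = 0 ∧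
    u 1 ⟨(1, 1), le_rfl⟩ + (A 0 0 * u 0 ⟨(0, 1), one_le_two⟩ + A 0 1 * u 1 ⟨(0, 1), one_le_two⟩ +
      (dY (A 0 0) * u 0 ⟨(0, 0), zero_le_two⟩ + dY (A 0 1) * u 1 ⟨(0, 0), zero_le_two⟩)) = 0 := by
  obtain ⟨-, hx, hy⟩ := (mem_bundleE A).1 hu
  rw [opMX_apply] at hx
  rw [opMY_apply] at hy
  have x1 := congrFun hx 1
  have x2 := congrFun hx 2
  have y0 := congrFun hy 0
  simp only [Pi.add_apply, Matrix.mulVec, dotProduct, Fin.sum_univ_two, Matrix.map_apply] at x1 x2 y0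
  exact ⟨x2, x1, y0⟩

theorem nablaX_apply (u : bundleE A) (j : Fin 2) (a b : ℕ) (h : a + b ≤ 1) :
    (nablaX A u).1 j ⟨(a, b), h.trans one_le_two⟩ =
      dX (u.1 j ⟨(a, b), h.trans one_le_two⟩) - u.1 j ⟨(a + 1, b), by dsimp only; omega⟩ := by
  have h1 := (projEquiv A).apply_symm_apply ⟨spencerX 1 u, spencerX_mem A u u.2⟩
  exact congrFun (congrFun (congrArg Subtype.val h1) j) ⟨(a, b), h⟩

theorem nablaY_apply (u : bundleE A) (j : Fin 2) (a b : ℕ) (h : a + b ≤ 1) :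
    (nablaY A u).1 j ⟨(a, b), h.trans one_le_two⟩ =
      dY (u.1 j ⟨(a, b), h.trans one_le_two⟩) - u.1 j ⟨(a, b + 1), by dsimp only; omega⟩ := by
  have h1 := (projEquiv A).apply_symm_apply ⟨spencerY 1 u, spencerY_mem A u u.2⟩
  exact congrFun (congrFun (congrArg Subtype.val h1) j) ⟨(a, b), h⟩

theorem curvature_apply_value (u : bundleE A) (j : Fin 2) :
    (curvature A u).1 j ⟨(0, 0), zero_le_two⟩ = 0 := by
  have hx := nablaX_apply A (nablaY A u) j 0 0 zero_le_one
  have hy := nablaY_apply A (nablaX A u) j 0 0 zero_le_one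
  have hxx := nablaX_apply A u j 0 0 zero_le_one
  have hyy := nablaY_apply A u j 0 0 zero_le_one
  have hxy := nablaX_apply A u j 0 1 le_rfl
  have hyx := nablaY_apply A u j 1 0 le_rfl
  rw [hyy, map_sub] at hx
  rw [hxx, map_sub] at hy
  change (nablaX A (nablaY A u)).1 j ⟨(0, 0), zero_le_two⟩ -
    (nablaY A (nablaX A u)).1 j ⟨(0, 0), zero_le_two⟩ = 0
  linear_combination hx - hy - hyx + hxy + dX_dY_comm (u.1 j ⟨(0, 0), zero_le_two⟩)

/-- The algebraic identity behind the curvature formula: the letters stand for the slots of a jet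
in `E`, and `vb, …`, `tb, …` for those of its `y`- and `x`-covariant derivatives. -/
theorem curvature_identity {b c bx by' cx cy bxx bxy cxy vb vc vbx vcx vby vcy vcxy vbxx
      tb tc tbx tcx tbxy : 𝒪}
    (r0 : cx + (A 0 0 * b + A 0 1 * c) = 0)
    (r1 : bx + cy + (A 1 0 * b + A 1 1 * c) = 0)
    (r2 : by' + (A 2 0 * b + A 2 1 * c) = 0)
    (s2 : bxy + (A 2 0 * bx + A 2 1 * cx + (dX (A 2 0) * b + dX (A 2 1) * c)) = 0)
    (s1 : bxx + cxy + (A 1 0 * bx + A 1 1 * cx + (dX (A 1 0) * b + dX (A 1 1) * c)) = 0)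
    (s0 : cxy + (A 0 0 * by' + A 0 1 * cy + (dY (A 0 0) * b + dY (A 0 1) * c)) = 0)
    (hvb : vb = dY b - by') (hvc : vc = dY c - cy) (hvbx : vbx = dY bx - bxy)
    (v0 : vcx + (A 0 0 * vb + A 0 1 * vc) = 0)
    (v1 : vbx + vcy + (A 1 0 * vb + A 1 1 * vc) = 0)
    (v2 : vby + (A 2 0 * vb + A 2 1 * vc) = 0)
    (w1 : vbxx + vcxy + (A 1 0 * vbx + A 1 1 * vcx + (dX (A 1 0) * vb + dX (A 1 1) * vc)) = 0)
    (w0 : vcxy + (A 0 0 * vby + A 0 1 * vcy + (dY (A 0 0) * vb + dY (A 0 1) * vc)) = 0)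
    (htb : tb = dX b - bx) (htc : tc = dX c - cx) (htbx : tbx = dX bx - bxx)
    (t0 : tcx + (A 0 0 * tb + A 0 1 * tc) = 0)
    (w2 : tbxy + (A 2 0 * tbx + A 2 1 * tcx + (dX (A 2 0) * tb + dX (A 2 1) * tc)) = 0) :
    3 * (-dX bxy + dY bxx - vbxx + tbxy) =
      3 * kappa A * (3 * bx + (A 0 1 + 2 * A 1 0) * b + (A 1 1 - A 2 0) * c)
        + (3 * dX (kappa A) + condL₁ (cubicOf A)) * b
        - (3 * dY (kappa A) + condL₂ (cubicOf A)) * c := by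
  rw [← derivation_three_mul, ← derivation_three_mul, three_mul_kappa]
  simp only [condL₁, condL₂, cubicOf, Matrix.cons_val]
  obtain rfl : cx = -(A 0 0 * b + A 0 1 * c) := by linear_combination r0
  obtain rfl : by' = -(A 2 0 * b + A 2 1 * c) := by linear_combination r2
  obtain rfl : cy = -bx - (A 1 0 * b + A 1 1 * c) := by linear_combination r1
  obtain rfl := eq_neg_of_add_eq_zero_left s2
  obtain rfl := eq_neg_of_add_eq_zero_left s0
  rw [add_assoc] at s1
  obtain rfl := eq_neg_of_add_eq_zero_left s1
  obtain rfl := eq_neg_of_add_eq_zero_left v0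
  obtain rfl := eq_neg_of_add_eq_zero_left v2
  obtain rfl : vcy = -vbx - (A 1 0 * vb + A 1 1 * vc) := by linear_combination v1
  obtain rfl := eq_neg_of_add_eq_zero_left w0
  rw [add_assoc] at w1
  obtain rfl := eq_neg_of_add_eq_zero_left w1
  obtain rfl := eq_neg_of_add_eq_zero_left t0
  obtain rfl := eq_neg_of_add_eq_zero_left w2
  subst hvb hvc hvbx htb htc htbx
  simp only [map_add, map_sub, map_neg, derivation_mul, derivation_two, ← dX_dY_comm]
  ring

theorem curvature_apply_dx (u : bundleE A) :
    3 * (curvature A u).1 0 ⟨(1, 0), one_le_two⟩ =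
      3 * kappa A * (3 * u.1 0 ⟨(1, 0), one_le_two⟩
          + (A 0 1 + 2 * A 1 0) * u.1 0 ⟨(0, 0), zero_le_two⟩
          + (A 1 1 - A 2 0) * u.1 1 ⟨(0, 0), zero_le_two⟩)
        + (3 * dX (kappa A) + condL₁ (cubicOf A)) * u.1 0 ⟨(0, 0), zero_le_two⟩
        - (3 * dY (kappa A) + condL₂ (cubicOf A)) * u.1 1 ⟨(0, 0), zero_le_two⟩ := by
  have hR : ∀ w : bundleE A, proj 1 w.1 ∈ bundleR A := fun w => ((mem_bundleE A).1 w.2).1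
  have e1 : (curvature A u).1 0 ⟨(1, 0), one_le_two⟩ =
      -dX (u.1 0 ⟨(1, 1), le_rfl⟩) + dY (u.1 0 ⟨(2, 0), le_rfl⟩)
        - (nablaY A u).1 0 ⟨(2, 0), le_rfl⟩ + (nablaX A u).1 0 ⟨(1, 1), le_rfl⟩ := by
    have hx := nablaX_apply A (nablaY A u) 0 1 0 le_rfl
    have hy := nablaY_apply A (nablaX A u) 0 1 0 le_rfl
    rw [nablaY_apply A u 0 1 0 le_rfl, map_sub] at hx
    rw [nablaX_apply A u 0 1 0 le_rfl, map_sub] at hy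
    change (nablaX A (nablaY A u)).1 0 ⟨(1, 0), one_le_two⟩ -
      (nablaY A (nablaX A u)).1 0 ⟨(1, 0), one_le_two⟩ = _
    linear_combination hx - hy + dX_dY_comm (u.1 0 ⟨(1, 0), one_le_two⟩)
  rw [e1]
  obtain ⟨sX2, -, -⟩ := bundleE_second_order A (nablaX A u).2
  obtain ⟨-, sY1, sY0⟩ := bundleE_second_order A (nablaY A u).2
  obtain ⟨s2, s1, s0⟩ := bundleE_second_order A u.2
  obtain ⟨r0, r1, r2⟩ := (mem_bundleR_iff A).1 (hR u)
  obtain ⟨v0, v1, v2⟩ := (mem_bundleR_iff A).1 (hR (nablaY A u))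
  obtain ⟨t0, -, -⟩ := (mem_bundleR_iff A).1 (hR (nablaX A u))
  exact curvature_identity A r0 r1 r2 s2 s1 s0
    (nablaY_apply A u 0 0 0 zero_le_one) (nablaY_apply A u 1 0 0 zero_le_one)
    (nablaY_apply A u 0 1 0 le_rfl) v0 v1 v2 sY1 sY0
    (nablaX_apply A u 0 0 0 zero_le_one) (nablaX_apply A u 1 0 0 zero_le_one)
    (nablaX_apply A u 0 1 0 le_rfl) t0 sX2

/-- The coordinates `(3 ∂_x b₃ + (A₁₂ + 2 A₂₁) b₃ + (A₂₂ - A₃₁) b₄, b₃, - b₄)` on `R_0`. -/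
def coordsR : bundleR A →ₗ[𝒪] (Fin 3 → 𝒪) where
  toFun v := ![3 * v.1 0 ⟨(1, 0), le_rfl⟩
              + (A 0 1 + 2 * A 1 0) * v.1 0 ⟨(0, 0), zero_le_one⟩
              + (A 1 1 - A 2 0) * v.1 1 ⟨(0, 0), zero_le_one⟩,
            v.1 0 ⟨(0, 0), zero_le_one⟩,
            -v.1 1 ⟨(0, 0), zero_le_one⟩]
  map_add' u v := by
    funext k
    fin_cases k <;> simp <;> ring
  map_smul' c v := by
    funext k
    fin_cases k <;> simp <;> ring

/-- The `1`-jet satisfying the system, with given `b₃`, `b₄` and `∂_x b₃`. -/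
def jetR (b c bx : 𝒪) : Jet 1 := fun j α =>
  if α.1.1 + α.1.2 = 0 then ![b, c] j
  else if α.1.1 = 1 then ![bx, -(A 0 0 * b + A 0 1 * c)] j
  else ![-(A 2 0 * b + A 2 1 * c), -bx - (A 1 0 * b + A 1 1 * c)] j

theorem jetR_mem (b c bx : 𝒪) : jetR A b c bx ∈ bundleR A := by
  rw [mem_bundleR_iff]
  refine ⟨neg_add_cancel _, ?_, neg_add_cancel _⟩
  change bx + (-bx - (A 1 0 * b + A 1 1 * c)) + (A 1 0 * b + A 1 1 * c) = 0
  ring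

theorem coordsR_bijective : Function.Bijective (coordsR A) := by
  constructor
  · refine (injective_iff_map_eq_zero _).2 ?_
    rintro ⟨v, hv⟩ h
    obtain ⟨r0, r1, r2⟩ := (mem_bundleR_iff A).1 hv
    have h1 : v 0 ⟨(0, 0), zero_le_one⟩ = 0 := congrFun h 1
    have h2 : v 1 ⟨(0, 0), zero_le_one⟩ = 0 := neg_eq_zero.1 (congrFun h 2)
    have h0 : 3 * v 0 ⟨(1, 0), le_rfl⟩ + (A 0 1 + 2 * A 1 0) * v 0 ⟨(0, 0), zero_le_one⟩
      + (A 1 1 - A 2 0) * v 1 ⟨(0, 0), zero_le_one⟩ = 0 := congrFun h 0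
    rw [h1, h2, mul_zero, mul_zero, add_zero, add_zero] at h0
    have h0' := (isUnit_three.mul_right_eq_zero).1 h0
    simp only [h1, h2, h0', mul_zero, add_zero, zero_add] at r0 r1 r2
    apply Subtype.ext
    funext j ⟨⟨a, b⟩, hab⟩
    dsimp only at hab
    obtain ⟨rfl, rfl⟩ | ⟨rfl, rfl⟩ | ⟨rfl, rfl⟩ :
        (a = 0 ∧ b = 0) ∨ (a = 1 ∧ b = 0) ∨ (a = 0 ∧ b = 1) := by omega
    all_goals fin_cases j <;> assumption
  · intro c
    refine ⟨⟨jetR A (c 1) (-c 2) ((3⁻¹ : ℂ) • (c 0 - (A 0 1 + 2 * A 1 0) * c 1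
      + (A 1 1 - A 2 0) * c 2)), jetR_mem A _ _ _⟩, ?_⟩
    have h3 := three_mul_third_smul (c 0 - (A 0 1 + 2 * A 1 0) * c 1 + (A 1 1 - A 2 0) * c 2)
    funext k
    fin_cases k
    · change 3 * ((3⁻¹ : ℂ) • (c 0 - (A 0 1 + 2 * A 1 0) * c 1 + (A 1 1 - A 2 0) * c 2))
        + (A 0 1 + 2 * A 1 0) * c 1 + (A 1 1 - A 2 0) * -c 2 = c 0
      rw [h3]
      ring
    · rfl
    · exact neg_neg _

/-- The adapted basis of `E`. -/
def adaptedBasis : Module.Basis (Fin 3) 𝒪 (bundleE A) :=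
  Module.Basis.ofEquivFun
    ((projEquiv A).trans (LinearEquiv.ofBijective (coordsR A) (coordsR_bijective A)))

theorem adaptedBasis_equivFun (u : bundleE A) : (adaptedBasis A).equivFun u =
    ![3 * u.1 0 ⟨(1, 0), one_le_two⟩
              + (A 0 1 + 2 * A 1 0) * u.1 0 ⟨(0, 0), zero_le_two⟩
              + (A 1 1 - A 2 0) * u.1 1 ⟨(0, 0), zero_le_two⟩,
            u.1 0 ⟨(0, 0), zero_le_two⟩,
            -u.1 1 ⟨(0, 0), zero_le_two⟩] := by
  rw [adaptedBasis, Module.Basis.equivFun_ofEquivFun]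
  rfl

theorem isAdapted_adaptedBasis : IsAdapted A (adaptedBasis A) := by
  have h := adaptedBasis_equivFun A (adaptedBasis A 0)
  have h1 := congrFun h 1
  have h2 := congrFun h 2
  rw [Module.Basis.equivFun_self] at h1 h2
  funext j
  fin_cases j
  · exact h1.symm
  · exact neg_eq_zero.1 h2.symm

theorem toMatrix_curvature :
    LinearMap.toMatrix (adaptedBasis A) (adaptedBasis A) (curvature A) =
      !![3 * kappa A, 3 * dX (kappa A) + condL₁ (cubicOf A), 3 * dY (kappa A) + condL₂ (cubicOf A);
        0, 0, 0;
        0, 0, 0] := by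
  ext i j
  rw [LinearMap.toMatrix_apply, ← Module.Basis.equivFun_apply, adaptedBasis_equivFun,
    curvature_apply_value, curvature_apply_value, curvature_apply_dx]
  have h := adaptedBasis_equivFun A (adaptedBasis A j)
  have h0 := congrFun h 0
  have h1 := congrFun h 1
  have h2 := congrFun h 2
  rw [Module.Basis.equivFun_self] at h0 h1 h2
  simp only [Matrix.cons_val] at h0 h1 h2
  rw [← h0, ← h1, neg_eq_iff_eq_neg.1 h2.symm]
  fin_cases i <;> fin_cases j <;> simp

end

/-! ### Slopes, interpolation and the coefficients of `M(4)` -/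

namespace PlanarWeb

theorem evalZero_dX_germ {d : ℕ} (W : PlanarWeb d) (i : Fin d) :
    evalZero (dX (W.germ i)) = fderiv ℂ (W.f i) 0 (1, 0) := rfl

theorem evalZero_dY_germ {d : ℕ} (W : PlanarWeb d) (i : Fin d) :
    evalZero (dY (W.germ i)) = fderiv ℂ (W.f i) 0 (0, 1) := rfl

theorem Presents.isUnit_dY {d : ℕ} {W : PlanarWeb d} {F : 𝒪[X]} (h : W.Presents F) (hd : 2 ≤ d)
    (i : Fin d) : IsUnit (dY (W.germ i)) := by
  obtain ⟨⟨g, hg⟩, hR⟩ := h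
  apply isUnit_of_evalZero_ne_zero
  intro h0
  apply hR
  rw [← evalZero_apply, ← resultant_map_map, ← derivative_map]
  have hdeg : (F.map evalZero).natDegree ≤ d - 1 := by
    rw [hg, Polynomial.map_mul, Polynomial.map_prod, map_C]
    refine (natDegree_C_mul_le _ _).trans ((natDegree_prod_le _ _).trans ?_)
    rw [← Finset.add_sum_erase _ _ (Finset.mem_univ i)]
    have hi : natDegree (Polynomial.map evalZero (C (dY (W.germ i)) * X + C (dX (W.germ i)))) = 0 := by
      simp [h0]
    have hc : (Finset.univ.erase i).card = d - 1 := by simp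
    rw [hi, zero_add, ← hc, Finset.card_eq_sum_ones]
    refine Finset.sum_le_sum fun j _ => ?_
    rw [Polynomial.map_add, Polynomial.map_mul, map_C, map_C, map_X]
    exact natDegree_linear_le
  have hder := natDegree_derivative_le (F.map evalZero)
  exact resultant_eq_zero_of_lt_lt _ _ _ _ (by omega) (by omega)

section

variable {d : ℕ} {W : PlanarWeb d}

theorem dY_mul_slope {i : Fin d} (hY : IsUnit (dY (W.germ i))) :
    dY (W.germ i) * W.slope i = -dX (W.germ i) := by
  rw [slope, mul_left_comm, Ring.mul_inverse_cancel _ hY, mul_one]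

theorem isUnit_slope_sub (hY : ∀ i, IsUnit (dY (W.germ i)))
    {i j : Fin d} (hij : i ≠ j) : IsUnit (W.slope i - W.slope j) := by
  have h : IsUnit (dY (W.germ i) * dY (W.germ j) * (W.slope i - W.slope j)) := by
    apply isUnit_of_evalZero_ne_zero
    have e : dY (W.germ i) * dY (W.germ j) * (W.slope i - W.slope j) =
        dY (W.germ i) * dX (W.germ j) - dX (W.germ i) * dY (W.germ j) := by
      linear_combination dY (W.germ j) * dY_mul_slope (hY i) - dY (W.germ i) * dY_mul_slope (hY j)
    rw [e, map_sub, map_mul, map_mul, evalZero_dX_germ, evalZero_dY_germ, evalZero_dX_germ,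
      evalZero_dY_germ]
    intro h
    exact W.generalPosition i j hij (by linear_combination -h)
  exact isUnit_of_mul_isUnit_right h

theorem isUnit_det_vandermonde_slope (hY : ∀ i, IsUnit (dY (W.germ i))) :
    IsUnit (Matrix.vandermonde W.slope).det := by
  rw [Matrix.det_vandermonde]
  refine (IsUnit.prod_iff).2 fun i _ => (IsUnit.prod_iff).2 fun j hj => ?_
  exact isUnit_slope_sub hY (Finset.mem_Ioi.1 hj).ne'

theorem interpolate_eq (hY : ∀ i, IsUnit (dY (W.germ i)))
    {v c : Fin d → 𝒪} (h : ∀ i, v i = ∑ k, c k * W.slope i ^ (k : ℕ)) :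
    W.interpolate v = c := by
  have hv : v = Matrix.mulVec (Matrix.vandermonde W.slope) c := by
    funext i
    rw [h i, Matrix.mulVec, dotProduct]
    exact Finset.sum_congr rfl fun k _ => mul_comm _ _
  rw [interpolate, hv, Matrix.mulVec_mulVec,
    Matrix.nonsing_inv_mul _ (isUnit_det_vandermonde_slope hY), Matrix.one_mulVec]

theorem sum_interpolate_mul_slope_pow (hY : ∀ i, IsUnit (dY (W.germ i)))
    (v : Fin d → 𝒪) (i : Fin d) :
    ∑ k, W.interpolate v k * W.slope i ^ (k : ℕ) = v i := by
  have h : Matrix.mulVec (Matrix.vandermonde W.slope) (W.interpolate v) = v := by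
    rw [interpolate, Matrix.mulVec_mulVec,
      Matrix.mul_nonsing_inv _ (isUnit_det_vandermonde_slope hY), Matrix.one_mulVec]
  conv_rhs => rw [← h]
  rw [Matrix.mulVec, dotProduct]
  exact Finset.sum_congr rfl fun k _ => mul_comm _ _

end

theorem dX_slope_add {W : PlanarWeb 4} (hY : ∀ i, IsUnit (dY (W.germ i))) (i : Fin 4) :
    dX (W.slope i) + W.slope i * dY (W.slope i) =
    W.polyP 0 + W.polyP 1 * W.slope i + W.polyP 2 * W.slope i ^ 2 + W.polyP 3 * W.slope i ^ 3 := by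
  have h := sum_interpolate_mul_slope_pow hY (fun i => dX (W.slope i) + W.slope i * dY (W.slope i)) i
  rw [Fin.sum_univ_four] at h
  rw [← h]
  simp [polyP]

end PlanarWeb

theorem closedness_eq {W : PlanarWeb 4} {F : 𝒪[X]} {i : Fin 4} {r : 𝒪}
    (hr : (derivative F).eval (W.slope i) * r = 1) (b c : 𝒪) :
    closedness W F b c i =
      dX b * W.slope i + dX c + W.slope i * (dY b * W.slope i + dY c)
        + b * (dX (W.slope i) + W.slope i * dY (W.slope i))
        + (b * W.slope i + c) * (dY (W.slope i) - r * (dX ((derivative F).eval (W.slope i))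
          + W.slope i * dY ((derivative F).eval (W.slope i)))) := by
  have hu : IsUnit ((derivative F).eval (W.slope i)) := IsUnit.of_mul_eq_one _ hr
  have hinv : Ring.inverse ((derivative F).eval (W.slope i)) = r := by
    have h := Ring.mul_inverse_cancel _ hu
    exact hu.mul_left_cancel (h.trans hr.symm)
  simp only [closedness, hinv, derivation_mul, map_add, derivation_of_mul_eq_one _ hr]
  set Fp := (derivative F).eval (W.slope i)
  linear_combination (dX b * W.slope i + dX c + W.slope i * (dY b * W.slope i + dY c)
    + b * (dX (W.slope i) + W.slope i * dY (W.slope i))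
        + (b * W.slope i + c) * (dY (W.slope i)) - r * (b * W.slope i + c) * (dX Fp
          + W.slope i * dY Fp)) * hr

/-- The logarithmic derivative along the leaves of slope `p` of `g₀ (p - p₁) (p - p₂) (p - p₃)`. -/
theorem dY_sub_logDeriv {p p₁ p₂ p₃ g r s P₀ P₁ P₂ P₃ : 𝒪}
    (hr : g * ((p - p₁) * (p - p₂) * (p - p₃)) * r = 1) (hs : g * s = 1)
    (h : dX p + p * dY p = P₀ + P₁ * p + P₂ * p ^ 2 + P₃ * p ^ 3)
    (h₁ : dX p₁ + p₁ * dY p₁ = P₀ + P₁ * p₁ + P₂ * p₁ ^ 2 + P₃ * p₁ ^ 3)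
    (h₂ : dX p₂ + p₂ * dY p₂ = P₀ + P₁ * p₂ + P₂ * p₂ ^ 2 + P₃ * p₂ ^ 3)
    (h₃ : dX p₃ + p₃ * dY p₃ = P₀ + P₁ * p₃ + P₂ * p₃ ^ 2 + P₃ * p₃ ^ 3) :
    dY p - r * (dX (g * ((p - p₁) * (p - p₂) * (p - p₃)))
        + p * dY (g * ((p - p₁) * (p - p₂) * (p - p₃)))) =
      (dY p + dY p₁ + dY p₂ + dY p₃ - s * dX g - 3 * P₁ - P₂ * (p + p₁ + p₂ + p₃)
          - P₃ * (p ^ 2 + p₁ ^ 2 + p₂ ^ 2 + p₃ ^ 2))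
        + (-s * dY g - 2 * P₂ - P₃ * (p + p₁ + p₂ + p₃)) * p - P₃ * p ^ 2 := by
  have hu : IsUnit (g * ((p - p₁) * (p - p₂) * (p - p₃))) := IsUnit.of_mul_eq_one _ hr
  apply hu.mul_left_cancel
  set Fp := g * ((p - p₁) * (p - p₂) * (p - p₃)) with hFp
  have e : Fp * (dY p - r * (dX Fp + p * dY Fp)) = Fp * dY p - (dX Fp + p * dY Fp) := by
    linear_combination -(dX Fp + p * dY Fp) * hr
  rw [e, hFp]
  simp only [derivation_mul, map_sub, eq_sub_of_add_eq h, eq_sub_of_add_eq h₁, eq_sub_of_add_eq h₂,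
    eq_sub_of_add_eq h₃]
  linear_combination ((p - p₁) * (p - p₂) * (p - p₃)) * (dX g + p * dY g) * hs

theorem cubicOf_systemM {W : PlanarWeb 4} {F : 𝒪[X]} (hF : W.Presents F) :
    cubicOf (systemM W F) = W.polyP := by
  have hY : ∀ i, IsUnit (dY (W.germ i)) := hF.isUnit_dY (by norm_num)
  obtain ⟨⟨g, hg⟩, -⟩ := hF
  have hu : IsUnit ((g : 𝒪) * ∏ i, dY (W.germ i)) := g.isUnit.mul ((IsUnit.prod_iff).2 fun i _ => hY i)
  set g₀ : 𝒪 := g * ∏ i, dY (W.germ i) with hg₀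
  obtain ⟨s, hs⟩ := hu.exists_right_inv
  have hF' : F = C g₀ * ∏ i, (X - C (W.slope i)) := by
    rw [hg, hg₀, C_mul, map_prod, mul_assoc, ← Finset.prod_mul_distrib]
    refine congrArg (fun q => C (g : 𝒪) * q) (Finset.prod_congr rfl fun i _ => ?_)
    rw [mul_sub, ← C_mul, PlanarWeb.dY_mul_slope (hY i), C_neg, sub_neg_eq_add]
  rw [Fin.prod_univ_four] at hF'
  have hsub := fun i j (hij : i ≠ j) => PlanarWeb.isUnit_slope_sub hY hij
  have hP := fun i => PlanarWeb.dX_slope_add hY i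
  set p := W.slope with hp
  set P := W.polyP with hPdef
  set e₀ := dY (p 0) + dY (p 1) + dY (p 2) + dY (p 3) - s * dX g₀ - 3 * P 1
    - P 2 * (p 0 + p 1 + p 2 + p 3) - P 3 * (p 0 ^ 2 + p 1 ^ 2 + p 2 ^ 2 + p 3 ^ 2) with he₀
  set e₁ := -s * dY g₀ - 2 * P 2 - P 3 * (p 0 + p 1 + p 2 + p 3) with he₁
  have key : ∀ i, ∃ r, (derivative F).eval (p i) * r = 1 ∧
      dY (p i) - r * (dX ((derivative F).eval (p i)) + p i * dY ((derivative F).eval (p i))) =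
        e₀ + e₁ * p i - P 3 * p i ^ 2 := by
    have aux : ∀ i j k l : Fin 4, i ≠ j → i ≠ k → i ≠ l →
        (derivative F).eval (p i) = g₀ * ((p i - p j) * (p i - p k) * (p i - p l)) →
        e₀ = dY (p i) + dY (p j) + dY (p k) + dY (p l) - s * dX g₀ - 3 * P 1
          - P 2 * (p i + p j + p k + p l) - P 3 * (p i ^ 2 + p j ^ 2 + p k ^ 2 + p l ^ 2) →
        e₁ = -s * dY g₀ - 2 * P 2 - P 3 * (p i + p j + p k + p l) →
        ∃ r, (derivative F).eval (p i) * r = 1 ∧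
          dY (p i) - r * (dX ((derivative F).eval (p i)) + p i * dY ((derivative F).eval (p i))) =
            e₀ + e₁ * p i - P 3 * p i ^ 2 := by
      intro i j k l hij hik hil hFp h0 h1
      have hu' : IsUnit ((derivative F).eval (p i)) := by
        rw [hFp]
        exact hu.mul (((hsub i j hij).mul (hsub i k hik)).mul (hsub i l hil))
      obtain ⟨r, hr⟩ := hu'.exists_right_inv
      refine ⟨r, hr, ?_⟩
      rw [hFp] at hr ⊢
      rw [h0, h1]
      exact dY_sub_logDeriv hr hs (hP i) (hP j) (hP k) (hP l)
    intro i
    fin_cases i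
    · refine aux 0 1 2 3 (by decide) (by decide) (by decide) ?_ ?_ ?_
      · simp [hF', derivative_mul]
      · rw [he₀]
      · rw [he₁]
    · refine aux 1 0 2 3 (by decide) (by decide) (by decide) ?_ ?_ ?_
      · simp [hF', derivative_mul]
      · rw [he₀]; ring
      · rw [he₁]; ring
    · refine aux 2 0 1 3 (by decide) (by decide) (by decide) ?_ ?_ ?_
      · simp [hF', derivative_mul]
      · rw [he₀]; ring
      · rw [he₁]; ring
    · refine aux 3 0 1 2 (by decide) (by decide) (by decide) ?_ ?_ ?_
      · simp [hF', derivative_mul]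
      · rw [he₀]; ring
      · rw [he₁]; ring
  have h0 : W.interpolate (closedness W F 1 0) = ![P 0, P 1 + e₀, P 2 + e₁, 0] := by
    apply PlanarWeb.interpolate_eq hY
    intro i
    obtain ⟨r, hr, hk⟩ := key i
    rw [closedness_eq hr, ← hp, hk, hP i, Fin.sum_univ_four]
    simp
    ring
  have h1 : W.interpolate (closedness W F 0 1) = ![e₀, e₁, -P 3, 0] := by
    apply PlanarWeb.interpolate_eq hY
    intro i
    obtain ⟨r, hr, hk⟩ := key i
    rw [closedness_eq hr, ← hp, hk, hP i, Fin.sum_univ_four]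
    simp
    ring
  have hA0 : ∀ k, systemM W F k 0 = ![P 0, P 1 + e₀, P 2 + e₁, 0] k.castSucc := fun k =>
    congrFun h0 k.castSucc
  have hA1 : ∀ k, systemM W F k 1 = ![e₀, e₁, -P 3, 0] k.castSucc := fun k =>
    congrFun h1 k.castSucc
  funext k
  simp only [cubicOf, hA0, hA1]
  fin_cases k <;> simp

/-! ### Linear differential systems with analytic coefficients -/

section RadialEquation

/-- The Banach space of continuous maps `[0, 1] → E`. -/
def Curves (E : Type*) [NormedAddCommGroup E] : Type _ := C(unitInterval, E)

namespace Curves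

variable {E : Type*} [NormedAddCommGroup E]

instance : NormedAddCommGroup (Curves E) := inferInstanceAs (NormedAddCommGroup C(unitInterval, E))

instance [CompleteSpace E] : CompleteSpace (Curves E) :=
  inferInstanceAs (CompleteSpace C(unitInterval, E))

instance : CoeFun (Curves E) (fun _ => unitInterval → E) :=
  ⟨fun u => ContinuousMap.toFun u⟩

/-- A continuous map as an element of `Curves E`. -/
def mk (f : unitInterval → E) (hf : Continuous f) : Curves E := ContinuousMap.mk f hf

theorem continuous (u : Curves E) : Continuous u := ContinuousMap.continuous_toFun u

@[ext]
theorem ext {u v : Curves E} (h : ∀ t, u t = v t) : u = v := ContinuousMap.ext h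

theorem norm_le {u : Curves E} {C : ℝ} (hC : 0 ≤ C) : ‖u‖ ≤ C ↔ ∀ t, ‖u t‖ ≤ C :=
  ContinuousMap.norm_le _ hC

theorem norm_apply_le (u : Curves E) (t : unitInterval) : ‖u t‖ ≤ ‖u‖ :=
  ContinuousMap.norm_coe_le_norm _ t

theorem add_apply (u v : Curves E) (t : unitInterval) : (u + v) t = u t + v t := rfl

theorem mk_apply (f : unitInterval → E) (hf : Continuous f) (t : unitInterval) : mk f hf t = f t :=
  rfl

variable [NormedSpace ℂ E]

instance : NormedSpace ℂ (Curves E) := inferInstanceAs (NormedSpace ℂ C(unitInterval, E))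

theorem smul_apply (c : ℂ) (u : Curves E) (t : unitInterval) : (c • u) t = c • u t := rfl

/-- Evaluation at a point of `[0, 1]`. -/
def eval (t : unitInterval) : Curves E →L[ℂ] E :=
  LinearMap.mkContinuous
    { toFun := fun u => u t
      map_add' := fun _ _ => rfl
      map_smul' := fun _ _ => rfl } 1 (fun u => by
        rw [one_mul]
        exact norm_apply_le u t)

end Curves

variable {V E : Type*} [NormedAddCommGroup V] [NormedSpace ℂ V] [NormedAddCommGroup E]
  [NormedSpace ℂ E]

/-- The primitive vanishing at `0`, as an operator on `C([0, 1], E)`. -/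
def volterra : Curves E →L[ℂ] Curves E :=
  LinearMap.mkContinuous
    { toFun := fun u => Curves.mk (fun t => ∫ s in (0 : ℝ)..t, Set.IccExtend zero_le_one u s)
        ((intervalIntegral.continuous_primitive
          (fun _ _ => (u.continuous.Icc_extend').intervalIntegrable _ _) 0).comp
            continuous_subtype_val)
      map_add' := fun u v => by
        ext t
        exact intervalIntegral.integral_add ((u.continuous.Icc_extend').intervalIntegrable _ _)
          ((v.continuous.Icc_extend').intervalIntegrable _ _)
      map_smul' := fun c u => by
        ext t
        exact intervalIntegral.integral_smul c _ }
    1 (fun u => by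
      rw [one_mul]
      refine (Curves.norm_le (norm_nonneg u)).2 fun t => ?_
      have h := intervalIntegral.norm_integral_le_of_norm_le_const (a := (0 : ℝ)) (b := t)
        (C := ‖u‖) (f := Set.IccExtend zero_le_one u) fun s _ => u.norm_apply_le _
      refine h.trans ?_
      rw [sub_zero, abs_of_nonneg t.2.1]
      exact mul_le_of_le_one_right (norm_nonneg u) t.2.2)

theorem volterra_apply (u : Curves E) (t : unitInterval) :
    volterra u t = ∫ s in (0 : ℝ)..t, Set.IccExtend zero_le_one u s := rfl

/-- The operator `u ↦ (s ↦ s ^ n • L (u s))` on `C([0, 1], E)`, depending linearly on `L`. -/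
def weightedMul (n : ℕ) :
    (E →L[ℂ] E) →L[ℂ] Curves E →L[ℂ] Curves E :=
  LinearMap.mkContinuous₂
    (LinearMap.mk₂ ℂ (fun (L : E →L[ℂ] E) (u : Curves E) =>
        Curves.mk (fun s => (((s : ℝ) : ℂ) ^ n) • L (u s)) (by have := u.continuous; fun_prop))
      (fun L L' u => by ext s; simp [Curves.mk_apply, Curves.add_apply])
      (fun c L u => by ext s; simp [Curves.mk_apply, Curves.smul_apply, smul_comm c])
      (fun L u u' => by ext s; simp [Curves.mk_apply, Curves.add_apply])
      (fun c L u => by ext s; simp [Curves.mk_apply, Curves.smul_apply, smul_comm c]))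
    1 (fun L u => by
      refine (Curves.norm_le (by positivity)).2 fun s => ?_
      have hs : ‖(((s : ℝ) : ℂ) ^ n)‖ ≤ 1 := by
        rw [norm_pow, Complex.norm_real, Real.norm_of_nonneg s.2.1]
        exact pow_le_one₀ s.2.1 s.2.2
      calc ‖(((s : ℝ) : ℂ) ^ n) • L (u s)‖ ≤ 1 * (‖L‖ * ‖u‖) := by
            rw [norm_smul]
            exact mul_le_mul hs ((L.le_opNorm _).trans (by gcongr; exact u.norm_apply_le s))
              (norm_nonneg _) zero_le_one
        _ = 1 * ‖L‖ * ‖u‖ := by ring)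

theorem norm_weightedMul_le (n : ℕ) : ‖weightedMul (E := E) n‖ ≤ 1 :=
  LinearMap.mkContinuous₂_norm_le _ zero_le_one _

theorem hasDerivAt_ofReal_smul (y : V) (t : ℝ) : HasDerivAt (fun t : ℝ => (t : ℂ) • y) y t := by
  simpa using (Complex.ofRealCLM.hasDerivAt (x := t)).smul_const y

theorem eventually_norm_le_of_analyticAt {f : V → E} (hf : AnalyticAt ℂ f 0) :
    ∃ C, ∀ᶠ z in 𝓝 (0 : V), ‖f z‖ ≤ C :=
  ⟨‖f 0‖ + 1, hf.continuousAt.norm.eventually_le_const (lt_add_one _)⟩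

theorem hasDerivAt_comp_ofReal {f : ℂ → E} {f' : E} {t : ℝ} (hf : HasDerivAt f f' t) :
    HasDerivAt (fun s : ℝ => f s) f' t := by
  have h := (hf.hasFDerivAt.restrictScalars ℝ).comp_hasDerivAt t (Complex.ofRealCLM.hasDerivAt (x := t))
  simpa using! h

theorem hasDerivAt_comp_smul {f : V → E} {z : V} {t : ℂ} (hf : AnalyticAt ℂ f (t • z)) :
    HasDerivAt (fun t : ℂ => f (t • z)) (fderiv ℂ f (t • z) z) t := by
  have hz : HasDerivAt (fun t : ℂ => t • z) z t := by
    simpa using (hasDerivAt_id t).smul_const z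
  exact hf.differentiableAt.hasFDerivAt.comp_hasDerivAt t hz

theorem analyticAt_sum_smul {ι : Type*} [Fintype ι] {f : ι → V → ℂ} {z : V}
    (hf : ∀ k, AnalyticAt ℂ (f k) z) (c : ι → E) : AnalyticAt ℂ (fun z => ∑ k, f k z • c k) z :=
  Finset.analyticAt_fun_sum _ fun k _ => (hf k).smul analyticAt_const

theorem fderiv_sum_smul {ι : Type*} [Fintype ι] {f : ι → V → ℂ} {z : V}
    (hf : ∀ k, AnalyticAt ℂ (f k) z) (c : ι → E) (a : V) :
    fderiv ℂ (fun z => ∑ k, f k z • c k) z a = ∑ k, fderiv ℂ (f k) z a • c k := by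
  have h : HasFDerivAt (fun z => ∑ k, f k z • c k) (∑ k, (fderiv ℂ (f k) z).smulRight (c k)) z :=
    HasFDerivAt.fun_sum fun k _ => (hf k).differentiableAt.hasFDerivAt.smul_const (c k)
  rw [h.fderiv]
  simp

/-- The series of the operators `u ↦ (s ↦ s⁻¹ Θ(s z) u(s))`, where `p` is the series of `Θ`. -/
def dilationSeries (p : FormalMultilinearSeries ℂ V (E →L[ℂ] E)) :
    FormalMultilinearSeries ℂ V (Curves E →L[ℂ] Curves E) := fun n =>
  (weightedMul (n - 1)).compContinuousMultilinearMap (p n)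

theorem radius_le_radius_dilationSeries (p : FormalMultilinearSeries ℂ V (E →L[ℂ] E)) :
    p.radius ≤ (dilationSeries p).radius := by
  refine ENNReal.le_of_forall_nnreal_lt fun r hr => ?_
  obtain ⟨C, -, hC⟩ := p.norm_mul_pow_le_of_lt_radius hr
  refine FormalMultilinearSeries.le_radius_of_bound _ C fun n => (mul_le_mul_of_nonneg_right ?_
    (by positivity)).trans (hC n)
  refine (ContinuousLinearMap.norm_compContinuousMultilinearMap_le _ _).trans ?_
  exact mul_le_of_le_one_left (norm_nonneg _) (norm_weightedMul_le _)

variable [CompleteSpace E]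

theorem hasSum_dilationSeries {p : FormalMultilinearSeries ℂ V (E →L[ℂ] E)} {z : V}
    (hz : z ∈ Metric.eball (0 : V) p.radius) (u : Curves E) (s : unitInterval) :
    HasSum (fun n => (((s : ℝ) : ℂ) ^ (n - 1)) • p n (fun _ => z) (u s))
      ((dilationSeries p).sum z u s) := by
  have h := (dilationSeries p).hasSum (x := z)
    (Metric.eball_subset_eball (radius_le_radius_dilationSeries p) hz)
  let ev : (Curves E →L[ℂ] Curves E) →L[ℂ] E :=
    (Curves.eval s).comp (ContinuousLinearMap.apply ℂ _ u)
  exact h.mapL ev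

theorem dilationSeries_sum_smul {p : FormalMultilinearSeries ℂ V (E →L[ℂ] E)} (h0 : p 0 = 0) {z : V}
    (hz : z ∈ Metric.eball (0 : V) p.radius) (u w : Curves E) (l s s' : unitInterval)
    (hs : (s' : ℝ) = l * s) (hw : w s = u s') (hlz : ((l : ℝ) : ℂ) • z ∈ Metric.eball (0 : V) p.radius) :
    (dilationSeries p).sum (((l : ℝ) : ℂ) • z) w s = ((l : ℝ) : ℂ) • (dilationSeries p).sum z u s' := by
  refine (hasSum_dilationSeries hlz w s).unique ?_
  have h := (hasSum_dilationSeries hz u s').const_smul ((l : ℝ) : ℂ)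
  convert h using 1
  funext n
  rcases n with _ | n
  · simp [h0]
  · rw [hs, hw, (p (n + 1)).map_smul_univ (fun _ => ((l : ℝ) : ℂ)) (fun _ => z)]
    simp only [Finset.prod_const, Finset.card_univ, Fintype.card_fin, smul_apply,
      smul_smul, add_tsub_cancel_right]
    congr 1
    push_cast
    ring

theorem dilationSeries_sum_apply {Θ : V → E →L[ℂ] E} {p : FormalMultilinearSeries ℂ V (E →L[ℂ] E)}
    {r : ENNReal} (hp : HasFPowerSeriesOnBall Θ p 0 r) (h0 : p 0 = 0) {z : V}
    (hz : z ∈ Metric.eball (0 : V) r) (u : Curves E) (s : unitInterval)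
    (hs : (s : ℝ) ≠ 0) (hsz : ((s : ℝ) : ℂ) • z ∈ Metric.eball (0 : V) r) :
    (dilationSeries p).sum z u s = (((s : ℝ) : ℂ))⁻¹ • Θ (((s : ℝ) : ℂ) • z) (u s) := by
  refine (hasSum_dilationSeries (Metric.eball_subset_eball hp.r_le hz) u s).unique ?_
  have h := ((hp.hasSum hsz).mapL (ContinuousLinearMap.apply ℂ E (u s))).const_smul (((s : ℝ) : ℂ))⁻¹
  rw [zero_add, ContinuousLinearMap.apply_apply] at h
  convert h using 1
  funext n
  rcases n with _ | n
  · simp [h0]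
  · rw [ContinuousLinearMap.apply_apply,
      (p (n + 1)).map_smul_univ (fun _ => ((s : ℝ) : ℂ)) (fun _ => z)]
    have hs' : ((s : ℝ) : ℂ) ≠ 0 := by exact_mod_cast hs
    simp only [Finset.prod_const, Finset.card_univ, Fintype.card_fin, smul_apply,
      smul_smul, add_tsub_cancel_right]
    congr 1
    rw [pow_succ]
    field_simp

/-- Radial integration of a linear system: `E v = Θ v`, where `E` is the Euler field. -/
theorem exists_radial_solution {Θ : V → E →L[ℂ] E} (hΘ : AnalyticAt ℂ Θ 0) (h0 : Θ 0 = 0) (v₀ : E) :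
    ∃ v : V → E, AnalyticAt ℂ v 0 ∧ v 0 = v₀ ∧ ∀ᶠ z in 𝓝 0, fderiv ℂ v z z = Θ z (v z) := by
  obtain ⟨p, r, hp⟩ := hΘ
  have hp0 : p 0 = 0 := by
    ext1 m
    have h := hp.coeff_zero m
    rw [h, h0]
    rfl
  set R := (dilationSeries p).sum with hR
  have hRan : AnalyticAt ℂ R 0 :=
    ((dilationSeries p).hasFPowerSeriesOnBall
      ((hp.r_pos.trans_le hp.r_le).trans_le (radius_le_radius_dilationSeries p))).analyticAt
  have hR0 : R 0 = 0 := by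
    have h := (((dilationSeries p).hasFPowerSeriesOnBall
      ((hp.r_pos.trans_le hp.r_le).trans_le (radius_le_radius_dilationSeries p)))).coeff_zero
        (fun _ => 0)
    rw [hR, ← h, dilationSeries, hp0]
    simp
  let T : V → Curves E →L[ℂ] Curves E := fun z => volterra.comp (R z)
  have hT : AnalyticAt ℂ T 0 :=
    ((ContinuousLinearMap.compL ℂ (Curves E) (Curves E) (Curves E) volterra).analyticAt _).comp hRan
  have hT0 : T 0 = 0 := by simp [T, hR0]
  let c : Curves E := Curves.mk (fun _ => v₀) continuous_const
  let U : V → Curves E := fun z => Ring.inverse (1 - T z) c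
  have hU : AnalyticAt ℂ U 0 := by
    have h1 : AnalyticAt ℂ (fun z => Ring.inverse (1 - T z)) 0 := by
      have h := analyticAt_inverse_one_sub ℂ (Curves E →L[ℂ] Curves E)
      rw [← hT0] at h
      exact h.comp hT
    exact ((ContinuousLinearMap.apply ℂ (Curves E) c).analyticAt _).comp h1
  let v : V → E := fun z => U z 1
  have hv : AnalyticAt ℂ v 0 := ((Curves.eval (E := E) 1).analyticAt _).comp hU
  have hunit : ∀ᶠ z in 𝓝 0, IsUnit (1 - T z) := by
    have hc : ContinuousAt (fun z => 1 - T z) 0 := continuousAt_const.sub hT.continuousAt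
    refine hc.eventually_mem (Units.isOpen.mem_nhds ?_)
    change IsUnit (1 - T 0)
    rw [hT0, sub_zero]
    exact isUnit_one
  refine ⟨v, hv, ?_, ?_⟩
  · simp [v, U, hT0, c, Curves.mk_apply]
  have hrad : ∀ᶠ z in 𝓝 (0 : V), z ∈ Metric.eball (0 : V) r := Metric.eball_mem_nhds 0 hp.r_pos
  obtain ⟨ε, hε, hball⟩ := Metric.eventually_nhds_iff_ball.1
    (hunit.and (hrad.and hv.eventually_analyticAt))
  refine Metric.eventually_nhds_iff_ball.2 ⟨ε / 2, half_pos hε, fun z hz => ?_⟩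
  rw [mem_ball_zero_iff] at hz
  set y : V := (2 : ℂ) • z with hy
  have hyn : ‖y‖ < ε := by
    rw [hy, norm_smul, Complex.norm_ofNat]
    linarith
  have hly : ∀ l : unitInterval, ((l : ℝ) : ℂ) • y ∈ Metric.ball (0 : V) ε := fun l => by
    rw [mem_ball_zero_iff, norm_smul, Complex.norm_real, Real.norm_of_nonneg l.2.1]
    exact (mul_le_of_le_one_left (norm_nonneg _) l.2.2).trans_lt hyn
  obtain ⟨huy, hry, -⟩ := hball y (mem_ball_zero_iff.2 hyn)
  have hsol : ∀ w, IsUnit (1 - T w) → (1 - T w) (U w) = c := fun w hw => by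
    have h := Ring.mul_inverse_cancel _ hw
    exact DFunLike.congr_fun h c
  have huniq : ∀ w x, IsUnit (1 - T w) → (1 - T w) x = c → x = U w := fun w x hw hx => by
    have h := Ring.inverse_mul_cancel _ hw
    have h2 := DFunLike.congr_fun h x
    change Ring.inverse (1 - T w) ((1 - T w) x) = x at h2
    rw [hx] at h2
    exact h2.symm
  set g : ℝ → E := Set.IccExtend zero_le_one (R y (U y)) with hg
  have hgc : Continuous g := (R y (U y)).continuous.Icc_extend'
  have hUy : ∀ t : unitInterval, U y t = v₀ + ∫ s in (0 : ℝ)..t, g s := fun t => by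
    have h := congrArg (fun x : Curves E => x t) (hsol y huy)
    change U y t - ∫ s in (0 : ℝ)..t, g s = v₀ at h
    rw [← h, sub_add_cancel]
  have hscale : ∀ l : unitInterval, v (((l : ℝ) : ℂ) • y) = U y l := by
    intro l
    obtain ⟨hul, hrl, -⟩ := hball _ (hly l)
    let w : Curves E := Curves.mk (fun t => U y (l * t))
      ((U y).continuous.comp (continuous_const.mul continuous_id))
    have hw : w = U (((l : ℝ) : ℂ) • y) := by
      apply huniq _ _ hul
      ext t
      change U y (l * t) - volterra (R (((l : ℝ) : ℂ) • y) w) t = v₀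
      have h1 : volterra (R (((l : ℝ) : ℂ) • y) w) t = ∫ s in (0 : ℝ)..t, (l : ℝ) • g (l * s) := by
        rw [volterra_apply]
        apply intervalIntegral.integral_congr
        intro s hs
        rw [Set.uIcc_of_le t.2.1] at hs
        have hs1 : s ∈ Set.Icc (0 : ℝ) 1 := ⟨hs.1, hs.2.trans t.2.2⟩
        have hls : (l : ℝ) * s ∈ Set.Icc (0 : ℝ) 1 := (l * ⟨s, hs1⟩ : unitInterval).2
        simp only [hg]
        rw [Set.IccExtend_of_mem _ _ hs1, Set.IccExtend_of_mem _ _ hls]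
        rw [← Complex.coe_smul]
        exact dilationSeries_sum_smul hp0 (Metric.eball_subset_eball hp.r_le hry) (U y) w l ⟨s, hs1⟩
          ⟨l * s, hls⟩ rfl rfl (Metric.eball_subset_eball hp.r_le hrl)
      rw [h1, intervalIntegral.integral_smul, intervalIntegral.smul_integral_comp_mul_left, mul_zero,
        hUy]
      exact add_sub_cancel_right _ _
    change U (((l : ℝ) : ℂ) • y) 1 = U y l
    rw [← hw]
    change U y (l * 1) = U y l
    rw [mul_one]
  have hhalf : (((1 / 2 : ℝ) : ℂ)) • y = z := by
    rw [hy, smul_smul]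
    norm_num
  have hd1 : HasDerivAt (fun t : ℝ => v ((t : ℂ) • y)) (g (1 / 2)) (1 / 2) := by
    have h := (hgc.integral_hasStrictDerivAt 0 (1 / 2)).hasDerivAt.const_add v₀
    refine h.congr_of_eventuallyEq ?_
    filter_upwards [Ioo_mem_nhds (show (0 : ℝ) < 1 / 2 by norm_num) (show (1 / 2 : ℝ) < 1 by norm_num)]
      with t ht
    rw [← hUy ⟨t, ht.1.le, ht.2.le⟩, ← hscale]
  have hzan : AnalyticAt ℂ v z := (hball z (mem_ball_zero_iff.2 (by linarith))).2.2
  have hd2 : HasDerivAt (fun t : ℝ => v ((t : ℂ) • y)) (fderiv ℂ v z y) (1 / 2) := by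
    have h2 : HasFDerivAt v (fderiv ℂ v z) ((((1 / 2 : ℝ) : ℂ)) • y) := by
      rw [hhalf]
      exact hzan.differentiableAt.hasFDerivAt
    exact (h2.restrictScalars ℝ).comp_hasDerivAt (1 / 2 : ℝ) (hasDerivAt_ofReal_smul y _)
  have hmem : (1 / 2 : ℝ) ∈ Set.Icc (0 : ℝ) 1 := by norm_num
  have hghalf : g (1 / 2) = (2 : ℂ) • Θ z (v z) := by
    rw [hg, Set.IccExtend_of_mem _ _ hmem]
    have h := dilationSeries_sum_apply hp hp0 hry (U y) ⟨1 / 2, hmem⟩ (by norm_num)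
      (hball _ (hly ⟨1 / 2, hmem⟩)).2.1
    rw [← hscale ⟨1 / 2, hmem⟩] at h
    simp only [hhalf] at h
    rw [hR]
    refine h.trans ?_
    norm_num
  have h := hd2.unique hd1
  rw [hghalf, hy, map_smul] at h
  exact smul_right_injective E (two_ne_zero (α := ℂ)) h

/-- A flat linear system `dv = Ω v` with analytic coefficients has an analytic solution with any given
initial value. -/
theorem exists_flat_section {Ω : V → V →L[ℂ] E →L[ℂ] E} (hΩ : AnalyticAt ℂ Ω 0)
    (hflat : ∀ᶠ z in 𝓝 0, ∀ a b, fderiv ℂ Ω z a b + (Ω z b).comp (Ω z a) =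
      fderiv ℂ Ω z b a + (Ω z a).comp (Ω z b)) (v₀ : E) :
    ∃ v : V → E, AnalyticAt ℂ v 0 ∧ v 0 = v₀ ∧ ∀ᶠ z in 𝓝 0, ∀ a, fderiv ℂ v z a = Ω z a (v z) := by
  have hΘ : AnalyticAt ℂ (fun z => Ω z z) 0 :=
    AnalyticAt.comp₂ ((ContinuousLinearMap.id ℂ (V →L[ℂ] E →L[ℂ] E)).analyticAt_bilinear (Ω 0, 0)) hΩ
      analyticAt_id
  obtain ⟨v, hv, hv0, hrad⟩ := exists_radial_solution hΘ (by simp) v₀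
  refine ⟨v, hv, hv0, ?_⟩
  obtain ⟨C, hC⟩ := eventually_norm_le_of_analyticAt hΩ
  obtain ⟨ε, hε, hball⟩ := Metric.eventually_nhds_iff_ball.1
    (hC.and (hflat.and (hrad.and (hΩ.eventually_analyticAt.and hv.eventually_analyticAt))))
  refine Metric.eventually_nhds_iff_ball.2 ⟨ε, hε, fun z hz a => ?_⟩
  rw [mem_ball_zero_iff] at hz
  have hmem : ∀ t ∈ Set.Icc (0 : ℝ) 1, (t : ℂ) • z ∈ Metric.ball (0 : V) ε := fun t ht => by
    rw [mem_ball_zero_iff, norm_smul, Complex.norm_real, Real.norm_of_nonneg ht.1]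
    exact (mul_le_of_le_one_left (norm_nonneg _) ht.2).trans_lt hz
  let y : ℂ → E := fun t => t • (fderiv ℂ v (t • z) a - Ω (t • z) a (v (t • z)))
  have hder : ∀ t ∈ Set.Icc (0 : ℝ) 1,
      HasDerivAt (fun s : ℝ => y s) (Ω ((t : ℂ) • z) z (y t)) t := by
    intro t ht
    apply hasDerivAt_comp_ofReal
    have hw := hmem t ht
    set w : V := (t : ℂ) • z with hwdef
    obtain ⟨-, hflatw, hradw, hΩw, hvw⟩ := hball w hw
    have dv : HasFDerivAt v (fderiv ℂ v w) w := hvw.differentiableAt.hasFDerivAt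
    have ddv : HasFDerivAt (fderiv ℂ v) (fderiv ℂ (fderiv ℂ v) w) w :=
      hvw.fderiv.differentiableAt.hasFDerivAt
    have dΩ : HasFDerivAt Ω (fderiv ℂ Ω w) w := hΩw.differentiableAt.hasFDerivAt
    have h1 := hasDerivAt_comp_smul hvw.fderiv
    have h2 := hasDerivAt_comp_smul hΩw
    have h3 := hasDerivAt_comp_smul hvw
    have h5 := (hasDerivAt_id (t : ℂ)).smul ((h1.clm_apply (hasDerivAt_const (t : ℂ) a)).sub
      ((h2.clm_apply (hasDerivAt_const (t : ℂ) a)).clm_apply h3))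
    refine h5.congr_deriv ?_
    have e1 : fderiv ℂ (fderiv ℂ v) w a w + fderiv ℂ v w a =
        fderiv ℂ Ω w a w (v w) + Ω w a (v w) + Ω w w (fderiv ℂ v w a) := by
      have hl := ddv.clm_apply (hasFDerivAt_id w)
      have hr := (dΩ.clm_apply (hasFDerivAt_id w)).clm_apply dv
      have heq : (fun x => fderiv ℂ v x (id x)) =ᶠ[𝓝 w] fun x => Ω x (id x) (v x) := by
        filter_upwards [Metric.isOpen_ball.mem_nhds hw] with x hx using (hball x hx).2.2.1
      have h := DFunLike.congr_fun (hl.unique (hr.congr_of_eventuallyEq heq)) a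
      simp only [id_eq, add_apply, ContinuousLinearMap.comp_apply,
        ContinuousLinearMap.flip_apply, ContinuousLinearMap.id_apply] at h
      linear_combination (norm := module) h
    have e2 : fderiv ℂ (fderiv ℂ v) w a z = fderiv ℂ (fderiv ℂ v) w z a :=
      (hvw.contDiffAt.isSymmSndFDerivAt (n := 2) (by simp)).eq a z
    have e3 := DFunLike.congr_fun (hflatw a z) (v w)
    have e4 : (t : ℂ) • fderiv ℂ v w z = (t : ℂ) • Ω w z (v w) := by
      rw [← map_smul, ← smul_apply, ← map_smul]
      exact hradw
    have e5 := congrArg (Ω w a) e4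
    simp only [map_smul, hwdef, smul_apply, add_apply,
      ContinuousLinearMap.comp_apply] at e1 e3 e5
    simp only [y, ← hwdef] at e1 e3 e5 ⊢
    rw [map_smul, map_sub]
    simp only [id_eq, map_zero, add_zero, one_smul, Pi.sub_apply, ← hwdef]
    linear_combination (norm := module) e1 - (t : ℂ) • e2 + (t : ℂ) • e3 - e5
  have hzero := eq_zero_of_abs_deriv_le_mul_abs_self_of_eq_zero_right (f := fun s : ℝ => y s)
    (f' := fun t => Ω ((t : ℂ) • z) z (y t)) (K := C * ‖z‖) (a := 0) (b := 1)
    (fun t ht => (hder t ht).continuousAt.continuousWithinAt)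
    (fun t ht => (hder t ⟨ht.1, ht.2.le⟩).hasDerivWithinAt) (by simp [y])
    (fun t ht => by
      have hC' := (hball _ (hmem t ⟨ht.1, ht.2.le⟩)).1
      calc ‖Ω ((t : ℂ) • z) z (y t)‖ ≤ ‖Ω ((t : ℂ) • z)‖ * ‖z‖ * ‖y t‖ :=
            (Ω ((t : ℂ) • z)).le_opNorm₂ z (y t)
        _ ≤ C * ‖z‖ * ‖y t‖ := by gcongr)
    1 ⟨zero_le_one, le_rfl⟩
  simpa [y, sub_eq_zero] using hzero

/-- A version of `exists_flat_section` for `Ω = ∑ k, f k • c k` with constant `c k`. -/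
theorem exists_flat_section_sum {ι : Type*} [Fintype ι] {f : ι → V → ℂ}
    (hf : ∀ k, AnalyticAt ℂ (f k) 0) (c : ι → V →L[ℂ] E →L[ℂ] E)
    (hflat : ∀ᶠ z in 𝓝 0, ∀ a b u, (∑ k, fderiv ℂ (f k) z a • c k b u) +
        (∑ k, f k z • c k b (∑ l, f l z • c l a u)) =
      (∑ k, fderiv ℂ (f k) z b • c k a u) + (∑ k, f k z • c k a (∑ l, f l z • c l b u))) (v₀ : E) :
    ∃ v : V → E, AnalyticAt ℂ v 0 ∧ v 0 = v₀ ∧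
      ∀ᶠ z in 𝓝 0, ∀ a, fderiv ℂ v z a = ∑ k, f k z • c k a (v z) := by
  have hfl : ∀ᶠ z in 𝓝 0, ∀ a b, fderiv ℂ (fun z => ∑ k, f k z • c k) z a b +
      ((∑ k, f k z • c k) b).comp ((∑ k, f k z • c k) a) =
      fderiv ℂ (fun z => ∑ k, f k z • c k) z b a +
        ((∑ k, f k z • c k) a).comp ((∑ k, f k z • c k) b) := by
    filter_upwards [hflat, eventually_all.2 fun k => (hf k).eventually_analyticAt] with z hz hfz a b
    ext u
    have h := hz a b u
    have hd : ∀ a, fderiv ℂ (fun z => ∑ k, f k z • c k) z a = ∑ k, fderiv ℂ (f k) z a • c k :=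
      fun a => fderiv_sum_smul hfz c a
    rw [hd, hd]
    simpa only [add_apply, ContinuousLinearMap.comp_apply, sum_apply, smul_apply] using h
  obtain ⟨v, hv, hv0, h⟩ := exists_flat_section (analyticAt_sum_smul hf c) hfl v₀
  refine ⟨v, hv, hv0, h.mono fun z hz a => ?_⟩
  rw [hz a]
  simp only [sum_apply, smul_apply]

end RadialEquation

/-! ### Flat linear systems over `𝒪` -/

section FlatSystem

variable {n : Type*} [Fintype n]

theorem fderiv_apply_component {v : ℂ × ℂ → n → ℂ} {z : ℂ × ℂ} (hv : AnalyticAt ℂ v z) (i : n)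
    (a : ℂ × ℂ) : fderiv ℂ (fun z => v z i) z a = fderiv ℂ v z a i := by
  have h := hasFDerivAt_pi'.1 hv.differentiableAt.hasFDerivAt i
  rw [h.fderiv]
  rfl

variable [DecidableEq n]

/-- The constant form `dx ⊗ e_{ij}` (for `l = 0`) or `dy ⊗ e_{ij}` (for `l = 1`). -/
def elementaryForm (k : Fin 2 × n × n) : ℂ × ℂ →L[ℂ] (n → ℂ) →L[ℂ] (n → ℂ) :=
  (![ContinuousLinearMap.fst ℂ ℂ ℂ, ContinuousLinearMap.snd ℂ ℂ ℂ] k.1).smulRight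
    ((ContinuousLinearMap.single ℂ (fun _ : n => ℂ) k.2.1).comp
      (ContinuousLinearMap.proj (R := ℂ) (φ := fun _ : n => ℂ) k.2.2))

theorem sum_smul_elementaryForm (w : Fin 2 × n × n → ℂ) (a : ℂ × ℂ) (u : n → ℂ) :
    ∑ k, w k • elementaryForm k a u =
      a.1 • (Matrix.of fun i j => w (0, i, j)).mulVec u +
        a.2 • (Matrix.of fun i j => w (1, i, j)).mulVec u := by
  funext i
  simp only [Fintype.sum_prod_type, Fin.sum_univ_two, elementaryForm, Pi.add_apply, Finset.sum_apply,
    Pi.smul_apply, Matrix.mulVec, dotProduct, Matrix.of_apply, smul_eq_mul, Finset.mul_sum]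
  simp [Pi.single_apply]
  congr 1 <;> refine Finset.sum_congr rfl fun j _ => by ring

theorem toGerm_sum {f : n → ℂ × ℂ → ℂ} (hf : ∀ i, AnalyticAt ℂ (f i) 0) :
    ∑ i, toGerm (f i) (hf i) =
      toGerm (fun z => ∑ i, f i z) (Finset.analyticAt_fun_sum _ fun i _ => hf i) := by
  apply Subtype.ext
  have h : ∀ s : Finset n, (∑ i ∈ s, toGerm (f i) (hf i)).val =
      ((fun z => ∑ i ∈ s, f i z : ℂ × ℂ → ℂ) : Germ (𝓝 (0 : ℂ × ℂ)) ℂ) := by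
    intro s
    induction s using Finset.induction_on with
    | empty => rfl
    | insert i s his ih =>
      simp only [Finset.sum_insert his]
      change (toGerm (f i) (hf i)).val + (∑ i ∈ s, toGerm (f i) (hf i)).val = _
      rw [ih]
      rfl
  exact h Finset.univ

theorem exists_flat_germs {M N : Matrix n n 𝒪} (hflat : M.map dY + M * N = N.map dX + N * M)
    (v₀ : n → ℂ) : ∃ v : n → 𝒪, (∀ i, evalZero (v i) = v₀ i) ∧
      (∀ i, dX (v i) = M.mulVec v i) ∧ ∀ i, dY (v i) = N.mulVec v i := by
  choose m hm hmM using fun i j => exists_toGerm_eq (M i j)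
  choose k hk hkN using fun i j => exists_toGerm_eq (N i j)
  let f : Fin 2 × n × n → ℂ × ℂ → ℂ := fun l => ![m l.2.1 l.2.2, k l.2.1 l.2.2] l.1
  have hf : ∀ l, AnalyticAt ℂ (f l) 0 := by
    rintro ⟨l, i, j⟩
    fin_cases l
    · exact hm i j
    · exact hk i j
  have hev : ∀ᶠ z in 𝓝 (0 : ℂ × ℂ), ∀ i j, fderiv ℂ (m i j) z (0, 1) + ∑ l, m i l z * k l j z =
      fderiv ℂ (k i j) z (1, 0) + ∑ l, k i l z * m l j z := by
    refine eventually_all.2 fun i => eventually_all.2 fun j => ?_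
    have h := congrFun (congrFun hflat i) j
    simp only [Matrix.add_apply, Matrix.map_apply, Matrix.mul_apply, ← hmM, ← hkN, dX_toGerm,
      dY_toGerm, toGerm_mul, toGerm_sum, toGerm_add] at h
    filter_upwards [toGerm_eq_iff.1 h] with z hz
    simpa using hz
  have hfl : ∀ᶠ z in 𝓝 0, ∀ a b u, (∑ l, fderiv ℂ (f l) z a • elementaryForm l b u) +
        (∑ l, f l z • elementaryForm l b (∑ l, f l z • elementaryForm l a u)) =
      (∑ l, fderiv ℂ (f l) z b • elementaryForm l a u) +
        (∑ l, f l z • elementaryForm l a (∑ l, f l z • elementaryForm l b u)) := by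
    filter_upwards [hev] with z hz a b u
    simp only [sum_smul_elementaryForm, f, Matrix.cons_val]
    set Mz : Matrix n n ℂ := Matrix.of fun i j => m i j z
    set Nz : Matrix n n ℂ := Matrix.of fun i j => k i j z
    have hder : ∀ (g : n → n → ℂ × ℂ → ℂ) (a : ℂ × ℂ),
        (Matrix.of fun i j => fderiv ℂ (g i j) z a) =
          a.1 • (Matrix.of fun i j => fderiv ℂ (g i j) z (1, 0)) +
          a.2 • (Matrix.of fun i j => fderiv ℂ (g i j) z (0, 1)) := by
      intro g a
      ext i j
      simp only [Matrix.of_apply, Matrix.add_apply, Matrix.smul_apply, ← map_smul, ← map_add]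
      congr 1
      ext <;> simp
    have hMN : (Matrix.of fun i j => fderiv ℂ (m i j) z (0, 1)) + Mz * Nz =
        (Matrix.of fun i j => fderiv ℂ (k i j) z (1, 0)) + Nz * Mz := by
      ext i j
      simpa [Matrix.mul_apply, Mz, Nz] using hz i j
    have hMNu := congrArg (fun A => Matrix.mulVec A u) hMN
    simp only [Matrix.add_mulVec, ← Matrix.mulVec_mulVec] at hMNu
    rw [hder m a, hder m b, hder k a, hder k b]
    simp only [Matrix.add_mulVec, Matrix.smul_mulVec, Matrix.mulVec_add, Matrix.mulVec_smul]
    linear_combination (norm := module) (b.1 * a.2 - a.1 * b.2) • hMNu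
  obtain ⟨v, hv, hv0, hsol⟩ := exists_flat_section_sum hf elementaryForm hfl v₀
  have hvi : ∀ i, AnalyticAt ℂ (fun z => v z i) 0 := fun i =>
    ((ContinuousLinearMap.proj (R := ℂ) (φ := fun _ : n => ℂ) i).analyticAt _).comp hv
  refine ⟨fun i => toGerm (fun z => v z i) (hvi i), fun i => ?_, fun i => ?_, fun i => ?_⟩
  · rw [evalZero_toGerm, hv0]
  · simp only [dX_toGerm, Matrix.mulVec, dotProduct, ← hmM, toGerm_mul, toGerm_sum]
    rw [toGerm_eq_iff]
    filter_upwards [hsol, hv.eventually_analyticAt] with z hz hvz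
    rw [fderiv_apply_component hvz, hz, sum_smul_elementaryForm]
    simp [f, Matrix.mulVec, dotProduct]
  · simp only [dY_toGerm, Matrix.mulVec, dotProduct, ← hkN, toGerm_mul, toGerm_sum]
    rw [toGerm_eq_iff]
    filter_upwards [hsol, hv.eventually_analyticAt] with z hz hvz
    rw [fderiv_apply_component hvz, hz, sum_smul_elementaryForm]
    simp [f, Matrix.mulVec, dotProduct]

end FlatSystem

/-! ### Leaves -/

/-- `(x, y) ↦ (x, a x + b y)` with `b ≠ 0`. -/
def shearEquiv (a b : ℂ) (hb : b ≠ 0) : (ℂ × ℂ) ≃L[ℂ] ℂ × ℂ :=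
  LinearEquiv.toContinuousLinearEquiv
    { toFun := fun z => (z.1, a * z.1 + b * z.2)
      map_add' := fun z w => by ext <;> simp; ring
      map_smul' := fun c z => by ext <;> simp; ring
      invFun := fun z => (z.1, b⁻¹ * (z.2 - a * z.1))
      left_inv := fun z => by ext <;> simp; field_simp
      right_inv := fun z => by ext <;> simp; field_simp; ring }

theorem clm_apply_prod (L : ℂ × ℂ →L[ℂ] ℂ) (z : ℂ × ℂ) : L z = L (1, 0) * z.1 + L (0, 1) * z.2 := by
  have h : z = z.1 • ((1, 0) : ℂ × ℂ) + z.2 • ((0, 1) : ℂ × ℂ) := by ext <;> simp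
  conv_lhs => rw [h]
  rw [map_add, map_smul, map_smul, smul_eq_mul, smul_eq_mul]
  ring

/-- The level curves of a function with `∂_y F ≠ 0`, parametrised by `x`. -/
theorem exists_leaf_parametrisation {F : ℂ × ℂ → ℂ} {z₀ : ℂ × ℂ} (hF : AnalyticAt ℂ F z₀)
    (hy : fderiv ℂ F z₀ (0, 1) ≠ 0) :
    ∃ Ψ : ℂ × ℂ → ℂ × ℂ, AnalyticAt ℂ Ψ (z₀.1, F z₀) ∧ Ψ (z₀.1, F z₀) = z₀ ∧
      (∀ᶠ z in 𝓝 z₀, Ψ (z.1, F z) = z) ∧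
      ∀ᶠ q in 𝓝 (z₀.1, F z₀), (Ψ q).1 = q.1 ∧ F (Ψ q) = q.2 := by
  let H : ℂ × ℂ → ℂ × ℂ := fun z => (z.1, F z)
  have hH : AnalyticAt ℂ H z₀ := analyticAt_fst.prod hF
  let e := shearEquiv (fderiv ℂ F z₀ (1, 0)) (fderiv ℂ F z₀ (0, 1)) hy
  have hH' : HasFDerivAt H (e : ℂ × ℂ →L[ℂ] ℂ × ℂ) z₀ := by
    have h := (hasFDerivAt_fst (𝕜 := ℂ) (p := z₀)).prodMk hF.differentiableAt.hasFDerivAt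
    refine h.congr_fderiv ?_
    refine ContinuousLinearMap.ext fun z => ?_
    have h1 := clm_apply_prod (fderiv ℂ F z₀) z
    exact Prod.ext rfl h1
  have hs : HasStrictFDerivAt H (e : ℂ × ℂ →L[ℂ] ℂ × ℂ) z₀ :=
    (hH.contDiffAt (n := 1)).hasStrictFDerivAt' hH' (by simp)
  refine ⟨hs.localInverse H e z₀, ?_, hs.localInverse_apply_image, hs.eventually_left_inverse, ?_⟩
  · have h := (hH.contDiffAt (n := ω)).to_localInverse hH' (by simp)
    exact h.analyticAt
  · filter_upwards [hs.eventually_right_inverse] with q hq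
    have h1 := congrArg Prod.fst hq
    have h2 := congrArg Prod.snd hq
    exact ⟨h1, h2⟩

/-- Along the leaves, the derivative of `G` is `(∂_x G ∂_y F - ∂_y G ∂_x F) / ∂_y F`. -/
theorem hasDerivAt_comp_leaf {F G : ℂ × ℂ → ℂ} {Ψ : ℂ × ℂ → ℂ × ℂ} {q : ℂ × ℂ}
    (hΨ : AnalyticAt ℂ Ψ q) (hF : AnalyticAt ℂ F (Ψ q)) (hG : AnalyticAt ℂ G (Ψ q))
    (hy : fderiv ℂ F (Ψ q) (0, 1) ≠ 0) (hq : ∀ᶠ q in 𝓝 q, (Ψ q).1 = q.1 ∧ F (Ψ q) = q.2) :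
    HasDerivAt (fun s => G (Ψ (s, q.2))) ((fderiv ℂ G (Ψ q) (1, 0) * fderiv ℂ F (Ψ q) (0, 1) -
      fderiv ℂ G (Ψ q) (0, 1) * fderiv ℂ F (Ψ q) (1, 0)) / fderiv ℂ F (Ψ q) (0, 1)) q.1 := by
  have hc : HasDerivAt (fun s : ℂ => (s, q.2)) ((1, 0) : ℂ × ℂ) q.1 :=
    (hasDerivAt_id q.1).prodMk (hasDerivAt_const q.1 q.2)
  have hΨ' : HasDerivAt (fun s => Ψ (s, q.2)) (fderiv ℂ Ψ q (1, 0)) q.1 :=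
    HasFDerivAt.comp_hasDerivAt (f := fun s : ℂ => (s, q.2)) q.1
      (hΨ.differentiableAt.hasFDerivAt) hc
  set w := fderiv ℂ Ψ q (1, 0) with hw
  have hcomp : ∀ K : ℂ × ℂ → ℂ, AnalyticAt ℂ K (Ψ q) →
      HasDerivAt (fun s => K (Ψ (s, q.2))) (fderiv ℂ K (Ψ q) w) q.1 := fun K hK =>
    HasFDerivAt.comp_hasDerivAt (f := fun s : ℂ => Ψ (s, q.2)) q.1
      (hK.differentiableAt.hasFDerivAt) hΨ'
  have hev : ∀ᶠ s in 𝓝 q.1, (Ψ (s, q.2)).1 = s ∧ F (Ψ (s, q.2)) = q.2 :=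
    hc.continuousAt.eventually hq
  have h1 : w.1 = 1 := by
    have ha : HasDerivAt (fun s => (Ψ (s, q.2)).1) w.1 q.1 :=
      HasFDerivAt.comp_hasDerivAt (f := fun s : ℂ => Ψ (s, q.2)) q.1 hasFDerivAt_fst hΨ'
    exact ha.unique ((hasDerivAt_id q.1).congr_of_eventuallyEq (hev.mono fun s hs => hs.1))
  have h2 : fderiv ℂ F (Ψ q) w = 0 :=
    (hcomp F hF).unique ((hasDerivAt_const q.1 q.2).congr_of_eventuallyEq (hev.mono fun s hs => hs.2))
  refine (hcomp G hG).congr_deriv ?_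
  rw [clm_apply_prod, h1] at h2
  rw [clm_apply_prod, h1]
  field_simp
  linear_combination fderiv ℂ G (Ψ q) (0, 1) * h2

/-- A function whose differential is proportional to `dF` is constant on the leaves of `F`. -/
theorem exists_nhds_const_on_leaves {F G : ℂ × ℂ → ℂ} (hF : AnalyticAt ℂ F 0) (hG : AnalyticAt ℂ G 0)
    (hy : fderiv ℂ F 0 (0, 1) ≠ 0)
    (h : ∀ᶠ z in 𝓝 (0 : ℂ × ℂ), fderiv ℂ G z (1, 0) * fderiv ℂ F z (0, 1) -
      fderiv ℂ G z (0, 1) * fderiv ℂ F z (1, 0) = 0) :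
    ∃ U ∈ 𝓝 (0 : ℂ × ℂ), ∀ z ∈ U, ∀ z' ∈ U, F z = F z' → G z = G z' := by
  obtain ⟨Ψ, hΨ, hΨ0, hleft, hright⟩ := exists_leaf_parametrisation hF hy
  have hyev : ∀ᶠ z in 𝓝 (0 : ℂ × ℂ), fderiv ℂ F z (0, 1) ≠ 0 :=
    (analyticAt_fderiv_apply hF (0, 1)).continuousAt.eventually_ne hy
  have hΨc : Tendsto Ψ (𝓝 ((0 : ℂ × ℂ).1, F 0)) (𝓝 0) := by
    have hc := hΨ.continuousAt
    rw [ContinuousAt, hΨ0] at hc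
    exact hc
  have hD : ∀ᶠ q in 𝓝 ((0 : ℂ × ℂ).1, F 0), HasDerivAt (fun s => G (Ψ (s, q.2))) 0 q.1 := by
    filter_upwards [hΨ.eventually_analyticAt, hΨc.eventually hF.eventually_analyticAt,
      hΨc.eventually hG.eventually_analyticAt, hΨc.eventually hyev, hΨc.eventually h,
      hright.eventually_nhds] with q h1 h2 h3 h4 h5 h6
    have h7 := hasDerivAt_comp_leaf h1 h2 h3 h4 h6
    rwa [h5, zero_div] at h7
  obtain ⟨ε, hε, hball⟩ := Metric.eventually_nhds_iff_ball.1 hD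
  have hHc : ContinuousAt (fun z : ℂ × ℂ => (z.1, F z)) 0 := continuousAt_fst.prodMk hF.continuousAt
  refine ⟨_, hleft.and (hHc.eventually (Metric.ball_mem_nhds _ hε)), ?_⟩
  rintro z ⟨hz1, hz2⟩ z' ⟨hz1', hz2'⟩ hzz'
  change (z.1, F z) ∈ Metric.ball ((0 : ℂ × ℂ).1, F 0) ε at hz2
  change (z'.1, F z') ∈ Metric.ball ((0 : ℂ × ℂ).1, F 0) ε at hz2'
  rw [← ball_prod_same] at hz2 hz2'
  have hconst := (Metric.isOpen_ball (x := (0 : ℂ × ℂ).1) (ε := ε)).is_const_of_deriv_eq_zero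
    (f := fun s => G (Ψ (s, F z))) (convex_ball _ _).isPreconnected
    (fun s hs => (hball (s, F z) (by
      rw [← ball_prod_same]
      exact ⟨hs, hz2.2⟩)).differentiableAt.differentiableWithinAt)
    (fun s hs => (hball (s, F z) (by
      rw [← ball_prod_same]
      exact ⟨hs, hz2.2⟩)).deriv) hz2.1 hz2'.1
  simp only [hz1] at hconst
  rw [hconst, hzz', hz1']

/-- A function which vanishes on a leaf of `F` has there a differential proportional to `dF`. -/
theorem jacobian_eq_zero_of_vanish_on_leaf {F G : ℂ × ℂ → ℂ} {z : ℂ × ℂ} (hF : AnalyticAt ℂ F z)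
    (hG : AnalyticAt ℂ G z) (hy : fderiv ℂ F z (0, 1) ≠ 0)
    (h : ∀ᶠ z' in 𝓝 z, F z' = F z → G z' = 0) :
    fderiv ℂ G z (1, 0) * fderiv ℂ F z (0, 1) - fderiv ℂ G z (0, 1) * fderiv ℂ F z (1, 0) = 0 := by
  obtain ⟨Ψ, hΨ, hΨ0, hleft, hright⟩ := exists_leaf_parametrisation hF hy
  have hd := hasDerivAt_comp_leaf (q := (z.1, F z)) (G := G) hΨ (by rwa [hΨ0]) (by rwa [hΨ0])
    (by rwa [hΨ0]) hright
  rw [hΨ0] at hd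
  have hΨc : Tendsto Ψ (𝓝 (z.1, F z)) (𝓝 z) := by
    have hc := hΨ.continuousAt
    rw [ContinuousAt, hΨ0] at hc
    exact hc
  have hev : ∀ᶠ s in 𝓝 z.1, G (Ψ (s, F z)) = 0 := by
    have hc : ContinuousAt (fun s : ℂ => (s, F z)) z.1 := by fun_prop
    filter_upwards [hc.eventually (hΨc.eventually h), hc.eventually hright] with s h1 h2
    exact h1 h2.2
  have h0 := hd.unique ((hasDerivAt_const z.1 (0 : ℂ)).congr_of_eventuallyEq hev)
  exact (div_eq_zero_iff.1 h0).resolve_right hy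

/-! ### Lines -/

theorem collinear_of_line_equation {S : Set (ℂ × ℂ)} {a b c : ℂ} (hab : a ≠ 0 ∨ b ≠ 0)
    (h : ∀ p ∈ S, a * p.1 + b * p.2 + c = 0) : Collinear ℂ S := by
  rw [collinear_iff_exists_forall_eq_smul_vadd]
  rcases hab with ha | hb
  · refine ⟨(-c / a, 0), (-b / a, 1), fun p hp => ⟨p.2, ?_⟩⟩
    have hp' := h p hp
    ext
    · simp
      field_simp
      linear_combination hp'
    · simp
  · refine ⟨(0, -c / b), (1, -a / b), fun p hp => ⟨p.1, ?_⟩⟩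
    have hp' := h p hp
    ext
    · simp
    · simp
      field_simp
      linear_combination hp'

theorem Collinear.exists_line_equation {S : Set (ℂ × ℂ)} (h : Collinear ℂ S) :
    ∃ a b c : ℂ, (a ≠ 0 ∨ b ≠ 0) ∧ ∀ p ∈ S, a * p.1 + b * p.2 + c = 0 := by
  obtain ⟨p₀, v, hv⟩ := (collinear_iff_exists_forall_eq_smul_vadd S).1 h
  by_cases h0 : v = 0
  · refine ⟨1, 0, -p₀.1, Or.inl one_ne_zero, fun p hp => ?_⟩
    obtain ⟨r, rfl⟩ := hv p hp
    simp [h0]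
  · refine ⟨-v.2, v.1, v.2 * p₀.1 - v.1 * p₀.2, ?_, fun p hp => ?_⟩
    · by_contra! hc
      exact h0 (Prod.ext hc.2 (neg_eq_zero.1 hc.1))
    · obtain ⟨r, rfl⟩ := hv p hp
      simp
      ring

/-! ### A criterion of linearisability -/

/-- The germ `g` is constant on the leaves of the `i`-th foliation. -/
def LeafConstant {d : ℕ} (W : PlanarWeb d) (i : Fin d) (g : 𝒪) : Prop :=
  ∃ f, ∃ hf : AnalyticAt ℂ f 0, toGerm f hf = g ∧
    ∃ U ∈ 𝓝 (0 : ℂ × ℂ), ∀ z ∈ U, ∀ z' ∈ U, W.f i z = W.f i z' → f z = f z'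

theorem leafConstant_one {d : ℕ} (W : PlanarWeb d) (i : Fin d) : LeafConstant W i 1 :=
  ⟨fun _ => 1, analyticAt_const, rfl, Set.univ, univ_mem, fun _ _ _ _ _ => rfl⟩

theorem leafConstant_of_jacobian_eq_zero {d : ℕ} {W : PlanarWeb d} {i : Fin d}
    (hY : IsUnit (dY (W.germ i))) {g : 𝒪}
    (h : dX g * dY (W.germ i) - dY g * dX (W.germ i) = 0) : LeafConstant W i g := by
  obtain ⟨f, hf, rfl⟩ := exists_toGerm_eq g
  refine ⟨f, hf, rfl, ?_⟩
  have hy : fderiv ℂ (W.f i) 0 (0, 1) ≠ 0 := evalZero_ne_zero_of_isUnit hY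
  refine exists_nhds_const_on_leaves (W.analyticAt i) hf hy ?_
  rw [PlanarWeb.germ, dX_toGerm, dY_toGerm, dX_toGerm, dY_toGerm, toGerm_mul, toGerm_mul, toGerm_sub]
    at h
  exact Germ.coe_eq.1 (congrArg Subtype.val h)

theorem bijective_fderiv_prodMk {f g : ℂ × ℂ → ℂ} (hf : AnalyticAt ℂ f 0) (hg : AnalyticAt ℂ g 0) :
    Function.Bijective (fderiv ℂ (fun z => (f z, g z)) 0) ↔
      fderiv ℂ f 0 (1, 0) * fderiv ℂ g 0 (0, 1) - fderiv ℂ f 0 (0, 1) * fderiv ℂ g 0 (1, 0) ≠ 0 := by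
  have hd : ∀ z, fderiv ℂ (fun z => (f z, g z)) 0 z =
      (fderiv ℂ f 0 (1, 0) * z.1 + fderiv ℂ f 0 (0, 1) * z.2,
        fderiv ℂ g 0 (1, 0) * z.1 + fderiv ℂ g 0 (0, 1) * z.2) := by
    intro z
    rw [(hf.differentiableAt.hasFDerivAt.prodMk hg.differentiableAt.hasFDerivAt).fderiv,
      ← clm_apply_prod, ← clm_apply_prod]
    rfl
  have hinj : Function.Injective (fderiv ℂ (fun z => (f z, g z)) 0) ↔
      Function.Bijective (fderiv ℂ (fun z => (f z, g z)) 0) :=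
    ⟨fun h => ⟨h, (LinearMap.injective_iff_surjective
      (f := (fderiv ℂ (fun z => (f z, g z)) 0 : ℂ × ℂ →ₗ[ℂ] ℂ × ℂ))).1 h⟩, fun h => h.1⟩
  rw [← hinj, injective_iff_map_eq_zero]
  constructor
  · intro h h0
    have h1 := h (fderiv ℂ f 0 (0, 1), -fderiv ℂ f 0 (1, 0)) (by
      rw [hd]
      ext
      · simp; ring
      · simp only [Prod.snd_zero]
        linear_combination -h0)
    have h2 := h (fderiv ℂ g 0 (0, 1), -fderiv ℂ g 0 (1, 0)) (by
      rw [hd]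
      ext
      · simp only [Prod.fst_zero]
        linear_combination h0
      · simp; ring)
    rw [Prod.mk_eq_zero, neg_eq_zero] at h1 h2
    have h3 := h (1, 0) (by rw [hd, h1.2, h2.2]; simp)
    simp at h3
  · intro h z hz
    rw [hd, Prod.mk_eq_zero] at hz
    obtain ⟨h1, h2⟩ := hz
    ext
    · refine (mul_eq_zero.1 ?_).resolve_left h
      linear_combination fderiv ℂ g 0 (0, 1) * h1 - fderiv ℂ f 0 (0, 1) * h2
    · refine (mul_eq_zero.1 ?_).resolve_left h
      linear_combination -fderiv ℂ g 0 (1, 0) * h1 + fderiv ℂ f 0 (1, 0) * h2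

/-- If `X`, `Y` are coordinates in which the leaves satisfy equations `a X + b Y + c = 0` with
coefficients constant on the leaves, then the web is linearisable. -/
theorem linearisable_of_lines {d : ℕ} {W : PlanarWeb d} {X Y : 𝒪}
    (hJ : evalZero (dX X * dY Y - dY X * dX Y) ≠ 0)
    (h : ∀ i, ∃ a b c : 𝒪, LeafConstant W i a ∧ LeafConstant W i b ∧ LeafConstant W i c ∧
      a * X + b * Y + c = 0 ∧ (evalZero a ≠ 0 ∨ evalZero b ≠ 0)) : W.Linearisable := by
  obtain ⟨f, hf, rfl⟩ := exists_toGerm_eq X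
  obtain ⟨g, hg, rfl⟩ := exists_toGerm_eq Y
  refine ⟨fun z => (f z, g z), hf.prod hg, (bijective_fderiv_prodMk hf hg).2 hJ, ?_⟩
  have key : ∀ i, ∃ U ∈ 𝓝 (0 : ℂ × ℂ), ∀ z ∈ U,
      Collinear ℂ ((fun z => (f z, g z)) '' {z' ∈ U | W.f i z' = W.f i z}) := by
    intro i
    obtain ⟨_, _, _, ⟨a, ha, rfl, Ua, hUa, hca⟩, ⟨b, hb, rfl, Ub, hUb, hcb⟩,
      ⟨c, hc, rfl, Uc, hUc, hcc⟩, heq, hne⟩ := h i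
    rw [toGerm_mul, toGerm_mul, toGerm_add, toGerm_add] at heq
    have heq' : ∀ᶠ z in 𝓝 (0 : ℂ × ℂ), a z * f z + b z * g z + c z = 0 :=
      Germ.coe_eq.1 (congrArg Subtype.val heq)
    have hne' : ∀ᶠ z in 𝓝 (0 : ℂ × ℂ), a z ≠ 0 ∨ b z ≠ 0 := by
      rcases hne with hne | hne
      · exact (ha.continuousAt.eventually_ne hne).mono fun z hz => Or.inl hz
      · exact (hb.continuousAt.eventually_ne hne).mono fun z hz => Or.inr hz
    refine ⟨_, inter_mem (inter_mem (inter_mem hUa hUb) hUc) (heq'.and hne'), ?_⟩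
    rintro z ⟨⟨⟨hza, hzb⟩, hzc⟩, -, hzne⟩
    refine collinear_of_line_equation (a := a z) (b := b z) (c := c z) hzne ?_
    rintro _ ⟨z', ⟨⟨⟨⟨hza', hzb'⟩, hzc'⟩, hzeq, -⟩, hzz⟩, rfl⟩
    rw [← hca z' hza' z hza hzz, ← hcb z' hzb' z hzb hzz, ← hcc z' hzc' z hzc hzz]
    exact hzeq
  choose U hU hUc using key
  refine ⟨⋂ i, U i, iInter_mem.2 hU, fun i z hz => (hUc i z (Set.mem_iInter.1 hz i)).subset ?_⟩
  exact Set.image_mono fun z' hz' => ⟨Set.mem_iInter.1 hz'.1 i, hz'.2⟩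

/-! ### Linearisable webs satisfy `L₁ = L₂ = 0` -/

theorem solution_identity (A : Matrix (Fin 3) (Fin 2) 𝒪) {b c : 𝒪}
    (r0 : dX c + (A 0 0 * b + A 0 1 * c) = 0)
    (r1 : dX b + dY c + (A 1 0 * b + A 1 1 * c) = 0)
    (r2 : dY b + (A 2 0 * b + A 2 1 * c) = 0) :
    3 * kappa A * (3 * dX b + (A 0 1 + 2 * A 1 0) * b + (A 1 1 - A 2 0) * c)
        + (3 * dX (kappa A) + condL₁ (cubicOf A)) * b
        - (3 * dY (kappa A) + condL₂ (cubicOf A)) * c = 0 := by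
  have s2 := congrArg dX r2
  have s1 := congrArg dX r1
  have s0 := congrArg dY r0
  simp only [map_add, derivation_mul, map_zero] at s0 s1 s2
  have h := curvature_identity A (b := b) (c := c) (bx := dX b) (by' := dY b) (cx := dX c)
    (cy := dY c) (bxx := dX (dX b)) (bxy := dX (dY b)) (cxy := dX (dY c)) (vb := 0) (vc := 0)
    (vbx := 0) (vcx := 0) (vby := 0) (vcy := 0) (vcxy := 0) (vbxx := 0) (tb := 0) (tc := 0)
    (tbx := 0) (tcx := 0) (tbxy := 0) r0 r1 r2 (by linear_combination s2)
    (by linear_combination s1) (by linear_combination s0 + dX_dY_comm c)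
    (by ring) (by ring) (by rw [dX_dY_comm]; ring) (by ring) (by ring) (by ring) (by ring) (by ring)
    (by ring) (by ring) (by ring) (by ring) (by ring)
  rw [← h, dX_dY_comm b, dX_dY_comm (dX b)]
  ring

/-- The derivation along the leaves of `f`, up to a factor. -/
def leafDeriv (f : 𝒪) (g : 𝒪) : 𝒪 := dX g * dY f - dY g * dX f

theorem leafDeriv_toGerm {f g : ℂ × ℂ → ℂ} (hf : AnalyticAt ℂ f 0) (hg : AnalyticAt ℂ g 0) :
    ∃ h, leafDeriv (toGerm f hf) (toGerm g hg) =
      toGerm (fun z => fderiv ℂ g z (1, 0) * fderiv ℂ f z (0, 1) -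
        fderiv ℂ g z (0, 1) * fderiv ℂ f z (1, 0)) h :=
  ⟨((analyticAt_fderiv_apply hg _).mul (analyticAt_fderiv_apply hf _)).sub
    ((analyticAt_fderiv_apply hg _).mul (analyticAt_fderiv_apply hf _)), rfl⟩

theorem Linearisable.exists_coordinates {d : ℕ} {W : PlanarWeb d} (h : W.Linearisable)
    (hY : ∀ i, IsUnit (dY (W.germ i))) :
    ∃ X Y : 𝒪, IsUnit (dX X * dY Y - dX Y * dY X) ∧ ∀ i,
      leafDeriv (W.germ i) X * leafDeriv (W.germ i) (leafDeriv (W.germ i) Y) =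
      leafDeriv (W.germ i) Y * leafDeriv (W.germ i) (leafDeriv (W.germ i) X) := by
  obtain ⟨φ, hφ, hbij, U, hU, hcol⟩ := h
  have hf : AnalyticAt ℂ (fun z => (φ z).1) 0 := analyticAt_fst.comp hφ
  have hg : AnalyticAt ℂ (fun z => (φ z).2) 0 := analyticAt_snd.comp hφ
  set f := fun z => (φ z).1 with hfdef
  set g := fun z => (φ z).2 with hgdef
  refine ⟨toGerm f hf, toGerm g hg, ?_, fun i => ?_⟩
  · have h := (bijective_fderiv_prodMk hf hg).1 hbij
    apply isUnit_of_evalZero_ne_zero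
    intro h0
    rw [map_sub, map_mul, map_mul] at h0
    refine h (Eq.trans ?_ h0)
    rw [mul_comm (fderiv ℂ f 0 (0, 1))]
    rfl
  · let F := W.f i
    have hF : AnalyticAt ℂ F 0 := W.analyticAt i
    let δ : (ℂ × ℂ → ℂ) → ℂ × ℂ → ℂ := fun k z => fderiv ℂ k z (1, 0) * fderiv ℂ F z (0, 1) -
        fderiv ℂ k z (0, 1) * fderiv ℂ F z (1, 0)
    obtain ⟨hδf, ef⟩ := leafDeriv_toGerm hF hf
    obtain ⟨hδg, eg⟩ := leafDeriv_toGerm hF hg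
    obtain ⟨hδδf, eff⟩ := leafDeriv_toGerm hF hδf
    obtain ⟨hδδg, egg⟩ := leafDeriv_toGerm hF hδg
    rw [PlanarWeb.germ, ef, eg, eff, egg, toGerm_mul, toGerm_mul, toGerm_eq_iff]
    change (δ f * δ (δ g)) =ᶠ[𝓝 0] (δ g * δ (δ f))
    have hδ : ∀ (k : ℂ × ℂ → ℂ) (z : ℂ × ℂ), AnalyticAt ℂ F z → AnalyticAt ℂ k z →
        AnalyticAt ℂ (δ k) z := fun k z hFz hkz =>
      ((analyticAt_fderiv_apply hkz _).mul (analyticAt_fderiv_apply hFz _)).sub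
        ((analyticAt_fderiv_apply hkz _).mul (analyticAt_fderiv_apply hFz _))
    have hδlin : ∀ (k l : ℂ × ℂ → ℂ) (a b c : ℂ) (z : ℂ × ℂ), AnalyticAt ℂ k z → AnalyticAt ℂ l z →
        δ (fun z => a * k z + b * l z + c) z = a * δ k z + b * δ l z := by
      intro k l a b c z hk hl
      have hd : HasFDerivAt (fun z => a * k z + b * l z + c)
          (a • fderiv ℂ k z + b • fderiv ℂ l z) z :=
        ((hk.differentiableAt.hasFDerivAt.const_mul a).add
          (hl.differentiableAt.hasFDerivAt.const_mul b)).add_const c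
      simp only [δ, hd.fderiv, add_apply, smul_apply, smul_eq_mul]
      ring
    have hyev : ∀ᶠ z in 𝓝 (0 : ℂ × ℂ), fderiv ℂ F z (0, 1) ≠ 0 :=
      (analyticAt_fderiv_apply hF (0, 1)).continuousAt.eventually_ne
        (evalZero_ne_zero_of_isUnit (hY i))
    have hgood : ∀ᶠ z in 𝓝 (0 : ℂ × ℂ), z ∈ U ∧ AnalyticAt ℂ F z ∧ AnalyticAt ℂ f z ∧
        AnalyticAt ℂ g z ∧ fderiv ℂ F z (0, 1) ≠ 0 := by
      filter_upwards [hU, hF.eventually_analyticAt, hf.eventually_analyticAt,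
        hg.eventually_analyticAt, hyev] with z h1 h2 h3 h4 h5 using ⟨h1, h2, h3, h4, h5⟩
    filter_upwards [hgood.eventually_nhds] with z hz
    obtain ⟨hzU, hzF, hzf, hzg, hzy⟩ := hz.self_of_nhds
    obtain ⟨a, b, c, hab, hline⟩ := Collinear.exists_line_equation (hcol i z hzU)
    let k : ℂ × ℂ → ℂ := fun z => a * f z + b * g z + c
    have hk0 : ∀ z' ∈ U, F z' = F z → k z' = 0 := fun z' hz' he =>
      hline (φ z') ⟨z', ⟨hz', he⟩, rfl⟩
    have hkan : ∀ z', AnalyticAt ℂ f z' → AnalyticAt ℂ g z' → AnalyticAt ℂ k z' := fun z' h1 h2 =>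
      ((analyticAt_const.mul h1).add (analyticAt_const.mul h2)).add analyticAt_const
    have hk1 : ∀ᶠ z' in 𝓝 z, F z' = F z → δ k z' = 0 := by
      filter_upwards [hz.eventually_nhds] with z' hz' he
      obtain ⟨-, hF', hf', hg', hy'⟩ := hz'.self_of_nhds
      refine jacobian_eq_zero_of_vanish_on_leaf hF' (hkan z' hf' hg') hy' ?_
      filter_upwards [hz'] with z'' hz'' he'
      exact hk0 z'' hz''.1 (he'.trans he)
    have e1 : δ k z = 0 := hk1.self_of_nhds rfl
    have e2 : δ (δ k) z = 0 :=
      jacobian_eq_zero_of_vanish_on_leaf hzF (hδ k z hzF (hkan z hzf hzg)) hzy hk1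
    have e3 : δ (δ k) z = a * δ (δ f) z + b * δ (δ g) z := by
      have heq : δ k =ᶠ[𝓝 z] fun z => a * δ f z + b * δ g z + 0 := by
        filter_upwards [hz] with z' hz'
        rw [add_zero]
        exact hδlin f g a b c z' hz'.2.2.1 hz'.2.2.2.1
      have h1 : δ (δ k) z = δ (fun z => a * δ f z + b * δ g z + 0) z := by
        simp only [δ] at heq ⊢
        rw [heq.fderiv_eq]
      rw [h1]
      exact hδlin (δ f) (δ g) a b 0 z (hδ f z hzF hzf) (hδ g z hzF hzg)
    rw [hδlin f g a b c z hzf hzg] at e1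
    rw [e3] at e2
    change δ f z * δ (δ g) z = δ g z * δ (δ f) z
    rcases hab with ha | hb
    · refine mul_left_cancel₀ ha ?_
      linear_combination δ (δ g) z * e1 - δ g z * e2
    · refine mul_left_cancel₀ hb ?_
      linear_combination -δ (δ f) z * e1 + δ f z * e2

theorem leafDeriv_eq {f p : 𝒪} (hp : dY f * p = -dX f) (g : 𝒪) :
    leafDeriv f g = dY f * (dX g + p * dY g) := by
  rw [leafDeriv]
  linear_combination -dY g * hp

/-- Straight leaves of slope `p`: the second derivatives of the coordinates along the leaves. -/
theorem acceleration_eq_zero {f p X Y : 𝒪} (hf : IsUnit (dY f)) (hp : dY f * p = -dX f)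
    (h : leafDeriv f X * leafDeriv f (leafDeriv f Y) = leafDeriv f Y * leafDeriv f (leafDeriv f X)) :
    (dX X + p * dY X) * (dX (dX Y) + 2 * p * dX (dY Y) + p ^ 2 * dY (dY Y)
        + (dX p + p * dY p) * dY Y) =
      (dX Y + p * dY Y) * (dX (dX X) + 2 * p * dX (dY X) + p ^ 2 * dY (dY X)
        + (dX p + p * dY p) * dY X) := by
  have hD : ∀ g, leafDeriv f (leafDeriv f g) = dY f ^ 2 * (dX (dX g) + 2 * p * dX (dY g)
      + p ^ 2 * dY (dY g) + (dX p + p * dY p) * dY g)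
      + dY f * (dX (dY f) + p * dY (dY f)) * (dX g + p * dY g) := by
    intro g
    rw [leafDeriv_eq hp, leafDeriv_eq hp g]
    simp only [derivation_mul, map_add, ← dX_dY_comm g]
    ring
  rw [hD, hD, leafDeriv_eq hp, leafDeriv_eq hp] at h
  refine (hf.pow 3).mul_left_cancel ?_
  linear_combination h

theorem condL_eq_zero_of_linearisable {W : PlanarWeb 4} (hY : ∀ i, IsUnit (dY (W.germ i)))
    (h : W.Linearisable) : condL₁ W.polyP = 0 ∧ condL₂ W.polyP = 0 := by
  obtain ⟨X, Y, hJ, hleaf⟩ := Linearisable.exists_coordinates h hY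
  obtain ⟨j, hj⟩ := hJ.exists_right_inv
  set A : Matrix (Fin 3) (Fin 2) 𝒪 :=
    !![-j * (dX X * dX (dX Y) - dX Y * dX (dX X)), -j * (dY Y * dX (dX X) - dY X * dX (dX Y));
      -2 * j * (dX X * dX (dY Y) - dX Y * dX (dY X)), -2 * j * (dY Y * dX (dY X) - dY X * dX (dY Y));
      -j * (dX X * dY (dY Y) - dX Y * dY (dY X)), -j * (dY Y * dY (dY X) - dY X * dY (dY Y))]
    with hA
  have hP : cubicOf A = W.polyP := by
    symm
    apply PlanarWeb.interpolate_eq hY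
    intro i
    have hp := PlanarWeb.dY_mul_slope (hY i)
    have hl := hleaf i
    have hl := acceleration_eq_zero (hY i) hp (hleaf i)
    rw [Fin.sum_univ_four]
    simp only [cubicOf, hA, Matrix.of_apply, Matrix.cons_val', Matrix.cons_val, Fin.coe_ofNat_eq_mod]
    norm_num
    linear_combination j * hl - (dX (W.slope i) + W.slope i * dY (W.slope i)) * hj
  have h00 : A 0 0 = -j * (dX X * dX (dX Y) - dX Y * dX (dX X)) := rfl
  have h01 : A 0 1 = -j * (dY Y * dX (dX X) - dY X * dX (dX Y)) := rfl
  have h10 : A 1 0 = -2 * j * (dX X * dX (dY Y) - dX Y * dX (dY X)) := rfl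
  have h11 : A 1 1 = -2 * j * (dY Y * dX (dY X) - dY X * dX (dY Y)) := rfl
  have h20 : A 2 0 = -j * (dX X * dY (dY Y) - dX Y * dY (dY X)) := rfl
  have h21 : A 2 1 = -j * (dY Y * dY (dY X) - dY X * dY (dY Y)) := rfl
  rw [← hP]
  have X0 : dX (dX X) + (A 0 0 * dY X + A 0 1 * dX X) = 0 := by
    rw [h00, h01]; linear_combination -dX (dX X) * hj
  have X1 : 2 * dX (dY X) + (A 1 0 * dY X + A 1 1 * dX X) = 0 := by
    rw [h10, h11]; linear_combination -2 * dX (dY X) * hj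
  have X2 : dY (dY X) + (A 2 0 * dY X + A 2 1 * dX X) = 0 := by
    rw [h20, h21]; linear_combination -dY (dY X) * hj
  have Y0 : dX (dX Y) + (A 0 0 * dY Y + A 0 1 * dX Y) = 0 := by
    rw [h00, h01]; linear_combination -dX (dX Y) * hj
  have Y1 : 2 * dX (dY Y) + (A 1 0 * dY Y + A 1 1 * dX Y) = 0 := by
    rw [h10, h11]; linear_combination -2 * dX (dY Y) * hj
  have Y2 : dY (dY Y) + (A 2 0 * dY Y + A 2 1 * dX Y) = 0 := by
    rw [h20, h21]; linear_combination -dY (dY Y) * hj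
  clear_value A
  have IX := solution_identity A (b := dY X) (c := dX X) X0
    (by rw [← dX_dY_comm]; linear_combination X1) X2
  have IY := solution_identity A (b := dY Y) (c := dX Y) Y0
    (by rw [← dX_dY_comm]; linear_combination Y1) Y2
  have I3 := solution_identity A (b := Y * dY X - X * dY Y) (c := Y * dX X - X * dX Y)
    (by simp only [map_sub, derivation_mul]; linear_combination Y * X0 - X * Y0)
    (by
      simp only [map_sub, derivation_mul, ← dX_dY_comm]
      linear_combination Y * X1 - X * Y1)
    (by simp only [map_sub, derivation_mul]; linear_combination Y * X2 - X * Y2)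
  simp only [map_sub, derivation_mul] at I3
  set k₂ := 3 * dX (kappa A) + condL₁ (cubicOf A) with hk₂
  set k₃ := 3 * dY (kappa A) + condL₂ (cubicOf A) with hk₃
  have hκ : kappa A = 0 := by
    have h1 : (3 * 3 * (dX X * dY Y - dX Y * dY X)) * kappa A = 0 := by
      linear_combination -I3 + Y * IX - X * IY
    exact (((isUnit_three.mul isUnit_three).mul hJ).mul_right_eq_zero).1 h1
  rw [hκ, mul_zero, zero_mul, zero_add] at IX IY
  have e2 : k₂ = 0 := by
    refine (hJ.mul_right_eq_zero).1 ?_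
    linear_combination dX X * IY - dX Y * IX
  have e3 : k₃ = 0 := by
    refine (hJ.mul_right_eq_zero).1 ?_
    linear_combination dY X * IY - dY Y * IX
  rw [hκ, map_zero, mul_zero, zero_add] at hk₂ hk₃
  exact ⟨hk₂.symm.trans e2, hk₃.symm.trans e3⟩

/-! ### Webs with `L₁ = L₂ = 0` are linearisable -/

/-- If `L₁ = L₂ = 0`, the system `M(4)` with `α = 0` attached to `P` (with `P 1 = 3 q₁` and
`P 2 = 3 q₂`) has a solution with any given initial value of `(∂_x b, b, c)`. -/
theorem exists_solution_of_condL_eq_zero {P : Fin 4 → 𝒪} {q₁ q₂ : 𝒪} (h₁ : P 1 = 3 * q₁)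
    (h₂ : P 2 = 3 * q₂) (hL₁ : condL₁ P = 0) (hL₂ : condL₂ P = 0) (v₀ : Fin 3 → ℂ) :
    ∃ b c : 𝒪, evalZero (dX b) = v₀ 0 ∧ evalZero b = v₀ 1 ∧ evalZero c = v₀ 2 ∧
      dX c + (P 0 * b - q₁ * c) = 0 ∧ dX b + dY c + (2 * q₁ * b - 2 * q₂ * c) = 0 ∧
      dY b + (q₂ * b - P 3 * c) = 0 := by
  let M : Matrix (Fin 3) (Fin 3) 𝒪 :=
    !![-q₁, -P 0 * q₂ + 2 * q₁ ^ 2 + dY (P 0) - 2 * dX q₁ - 2 * q₂ * P 0,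
          P 0 * P 3 - dY q₁ + 2 * dX q₂;
      1, 0, 0;
      0, -P 0, q₁]
  let N : Matrix (Fin 3) (Fin 3) 𝒪 :=
    !![-q₂, -P 3 * P 0 - dX q₂, P 3 * q₁ + dX (P 3);
      0, -q₂, P 3;
      -1, -2 * q₁, 2 * q₂]
  have hflat : M.map dY + M * N = N.map dX + N * M := by
    simp only [condL₁, condL₂, h₁, h₂, derivation_three_mul] at hL₁ hL₂
    ext i j
    rw [Matrix.add_apply, Matrix.add_apply, Matrix.mul_apply, Matrix.mul_apply, Matrix.map_apply,
      Matrix.map_apply, Fin.sum_univ_three, Fin.sum_univ_three]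
    fin_cases i <;> fin_cases j <;>
      simp only [M, N, Fin.zero_eta, Fin.mk_one, Fin.reduceFinMk, Matrix.of_apply, Matrix.cons_val',
        Matrix.cons_val, map_zero, map_neg, map_add, map_sub, derivation_mul, derivation_two, pow_two,
        Derivation.map_one_eq_zero, ← dX_dY_comm]
    · ring
    · refine isUnit_three.mul_left_cancel ?_
      linear_combination hL₁
    · refine isUnit_three.mul_left_cancel ?_
      linear_combination -hL₂
    all_goals ring
  obtain ⟨v, hv0, hvX, hvY⟩ := exists_flat_germs hflat v₀
  have x0 := hvX 0
  have x1 := hvX 1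
  have x2 := hvX 2
  have y1 := hvY 1
  have y2 := hvY 2
  simp only [M, N, Matrix.mulVec, dotProduct, Fin.sum_univ_three, Matrix.of_apply, Matrix.cons_val',
    Matrix.cons_val] at x0 x1 x2 y1 y2
  have x1' : dX (v 1) = v 0 := by linear_combination x1
  refine ⟨v 1, v 2, ?_, hv0 1, hv0 2, ?_, ?_, ?_⟩
  · rw [x1', hv0]
  · linear_combination x2
  · linear_combination x1 + y2
  · linear_combination y1

/-- The derivative along the leaves of `b p + c` for a solution `(b, c)`. -/
theorem derivation_mul_slope_add {P₀ P₃ q₁ q₂ p b c : 𝒪}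
    (hp : dX p + p * dY p = P₀ + 3 * q₁ * p + 3 * q₂ * p ^ 2 + P₃ * p ^ 3)
    (e₁ : dX c + (P₀ * b - q₁ * c) = 0) (e₂ : dX b + dY c + (2 * q₁ * b - 2 * q₂ * c) = 0)
    (e₃ : dY b + (q₂ * b - P₃ * c) = 0) :
    dX (b * p + c) + p * dY (b * p + c) = (q₁ + 2 * q₂ * p + P₃ * p ^ 2) * (b * p + c) := by
  rw [map_add, map_add, derivation_mul, derivation_mul]
  linear_combination b * hp + e₁ + p * e₂ + p ^ 2 * e₃

/-- Quotients of functions with the same logarithmic derivative along the leaves are constant on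
the leaves. -/
theorem leafConstant_mul_inverse {d : ℕ} {W : PlanarWeb d} {i : Fin d}
    (hY : IsUnit (dY (W.germ i))) {z w r l : 𝒪} (hr : w * r = 1)
    (hz : dX z + W.slope i * dY z = l * z) (hw : dX w + W.slope i * dY w = l * w) :
    LeafConstant W i (z * r) := by
  refine leafConstant_of_jacobian_eq_zero hY ?_
  have hp := W.dY_mul_slope hY
  rw [derivation_mul, derivation_mul, derivation_of_mul_eq_one dX hr,
    derivation_of_mul_eq_one dY hr]
  linear_combination (dY (W.germ i) * r) * hz - (dY (W.germ i) * z * r * r) * hw -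
    (dY (W.germ i) * z * l * r) * hr + (z * r * r * dY w - r * dY z) * hp

theorem linearisable_of_condL_eq_zero {W : PlanarWeb 4} (hY : ∀ i, IsUnit (dY (W.germ i)))
    (hL₁ : condL₁ W.polyP = 0) (hL₂ : condL₂ W.polyP = 0) : W.Linearisable := by
  set q₁ : 𝒪 := (3⁻¹ : ℂ) • W.polyP 1
  set q₂ : 𝒪 := (3⁻¹ : ℂ) • W.polyP 2
  have h₁ : W.polyP 1 = 3 * q₁ := (three_mul_third_smul _).symm
  have h₂ : W.polyP 2 = 3 * q₂ := (three_mul_third_smul _).symm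
  obtain ⟨b₁, c₁, ve₁, vb₁, vc₁, s₁, t₁, u₁⟩ :=
    exists_solution_of_condL_eq_zero h₁ h₂ hL₁ hL₂ ![0, 1, 0]
  obtain ⟨b₂, c₂, ve₂, vb₂, vc₂, s₂, t₂, u₂⟩ :=
    exists_solution_of_condL_eq_zero h₁ h₂ hL₁ hL₂ ![0, 0, 1]
  obtain ⟨b₃, c₃, ve₃, vb₃, vc₃, s₃, t₃, u₃⟩ :=
    exists_solution_of_condL_eq_zero h₁ h₂ hL₁ hL₂ ![1, 0, 0]
  simp only [Matrix.cons_val] at ve₁ vb₁ vc₁ ve₂ vb₂ vc₂ ve₃ vb₃ vc₃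
  obtain ⟨m, hm⟩ : ∃ m, (b₁ * c₂ - b₂ * c₁) * m = 1 := by
    refine (isUnit_of_evalZero_ne_zero ?_).exists_right_inv
    simp [vb₁, vb₂, vc₁, vc₂]
  refine linearisable_of_lines (X := (b₂ * c₃ - b₃ * c₂) * m) (Y := (b₃ * c₁ - b₁ * c₃) * m) ?_ ?_
  · have hm0 : evalZero m = 1 := by
      have h := congrArg evalZero hm
      simpa [vb₁, vb₂, vc₁, vc₂] using h
    have w₃ : evalZero (dY b₃) = 0 := by
      simpa [vb₃, vc₃] using congrArg evalZero u₃
    have x₃ : evalZero (dX c₃) = 0 := by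
      simpa [vb₃, vc₃] using congrArg evalZero s₃
    have y₃ : evalZero (dY c₃) = -1 := by
      have h : 1 + evalZero (dY c₃) = 0 := by simpa [vb₃, vc₃, ve₃] using congrArg evalZero t₃
      linear_combination h
    simp [ve₁, ve₂, ve₃, vb₁, vb₂, vb₃, vc₁, vc₂, vc₃, w₃, x₃, y₃, hm0]
  · intro i
    have hp := PlanarWeb.dX_slope_add hY i
    rw [h₁, h₂] at hp
    set p := W.slope i with hpdef
    obtain ⟨r, hr⟩ : ∃ r, (b₂ * p + c₂) * r = 1 := by
      refine (isUnit_of_evalZero_ne_zero ?_).exists_right_inv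
      simp [vb₂, vc₂]
    have d₁ := derivation_mul_slope_add hp s₁ t₁ u₁
    have d₂ := derivation_mul_slope_add hp s₂ t₂ u₂
    have d₃ := derivation_mul_slope_add hp s₃ t₃ u₃
    refine ⟨(b₁ * p + c₁) * r, 1, (b₃ * p + c₃) * r, leafConstant_mul_inverse (hY i) hr d₁ d₂,
      leafConstant_one W i, leafConstant_mul_inverse (hY i) hr d₃ d₂, ?_, Or.inr ?_⟩
    · linear_combination (-(b₃ * c₁ - b₁ * c₃) * m) * hr - ((b₃ * p + c₃) * r) * hm
    · simp

/-! ### Abelian relations and webs of maximal rank -/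

/-- The common leading power of finitely many germs of functions of one variable. -/
theorem exists_leading_part {ι : Type*} [Finite ι] {g : ι → ℂ → ℂ}
    (hg : ∀ i, AnalyticAt ℂ (g i) 0) (hne : ∃ i, ¬ ∀ᶠ t in 𝓝 0, g i t = 0) :
    ∃ (n : ℕ) (k : ι → ℂ → ℂ), (∀ i, AnalyticAt ℂ (k i) 0) ∧
      (∀ i, ∀ᶠ t in 𝓝 0, g i t = t ^ n * k i t) ∧ ∃ i, k i 0 ≠ 0 := by
  obtain ⟨j, hj⟩ := hne
  have : Nonempty ι := ⟨j⟩
  obtain ⟨i₀, hi₀⟩ := Finite.exists_min fun i => analyticOrderAt (g i) 0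
  have hfin : analyticOrderAt (g i₀) 0 ≠ ⊤ := fun h =>
    hj (analyticOrderAt_eq_top.1 (top_le_iff.1 (h ▸ hi₀ j)))
  obtain ⟨n, hn⟩ := ENat.ne_top_iff_exists.1 hfin
  have key : ∀ i, ∃ k : ℂ → ℂ, AnalyticAt ℂ k 0 ∧ (∀ᶠ t in 𝓝 0, g i t = t ^ n * k t) ∧
      (analyticOrderAt (g i) 0 = n → k 0 ≠ 0) := by
    intro i
    by_cases h : analyticOrderAt (g i) 0 = n
    · obtain ⟨k, hk, hk0, he⟩ := (hg i).analyticOrderAt_eq_natCast.1 h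
      exact ⟨k, hk, by simpa using he, fun _ => hk0⟩
    · obtain ⟨k, hk, he⟩ := (natCast_le_analyticOrderAt (hg i)).1 (hn.trans_le (hi₀ i))
      exact ⟨k, hk, by simpa using he, fun h' => absurd h' h⟩
  choose k hk he hk0 using key
  exact ⟨n, k, hk, he, i₀, hk0 i₀ hn.symm⟩

namespace PlanarWeb

variable {d : ℕ} {W : PlanarWeb d}

theorem analyticAt_comp (W : PlanarWeb d) {g : ℂ → ℂ} (hg : AnalyticAt ℂ g 0) (i : Fin d) :
    AnalyticAt ℂ (g ∘ W.f i) 0 :=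
  AnalyticAt.comp (by rwa [W.map_zero]) (W.analyticAt i)

theorem exists_functions_of_mem_abelianRelations {h : Fin d → 𝒪} (hh : h ∈ W.abelianRelations) :
    ∃ (g : Fin d → ℂ → ℂ) (hg : ∀ i, AnalyticAt ℂ (g i) 0),
      (∀ i, h i = toGerm (g i ∘ W.f i) (W.analyticAt_comp (hg i) i)) ∧
      ∀ w, ∀ᶠ z in 𝓝 (0 : ℂ × ℂ), ∑ i, g i (W.f i z) * fderiv ℂ (W.f i) z w = 0 := by
  obtain ⟨h1, h2, h3⟩ := hh
  choose g hg he using h1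
  have he' : ∀ i, h i = toGerm (g i ∘ W.f i) (W.analyticAt_comp (hg i) i) := fun i =>
    Subtype.ext (he i)
  refine ⟨g, hg, he', fun w => ?_⟩
  simp only [he', germ, dX_toGerm, dY_toGerm, toGerm_mul, toGerm_sum] at h2 h3
  have h2' := Germ.coe_eq.1 (congrArg Subtype.val h2)
  have h3' := Germ.coe_eq.1 (congrArg Subtype.val h3)
  filter_upwards [h2', h3'] with z hz2 hz3
  simp only [Pi.mul_apply, Function.comp_apply] at hz2 hz3
  have hsum : ∑ i, g i (W.f i z) * fderiv ℂ (W.f i) z w =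
      w.1 * ∑ i, g i (W.f i z) * fderiv ℂ (W.f i) z (1, 0) +
      w.2 * ∑ i, g i (W.f i z) * fderiv ℂ (W.f i) z (0, 1) := by
    rw [Finset.mul_sum, Finset.mul_sum, ← Finset.sum_add_distrib]
    refine Finset.sum_congr rfl fun i _ => ?_
    rw [clm_apply_prod _ w]
    ring
  rw [hsum, hz2, hz3]
  simp

/-- The lowest homogeneous part of an abelian relation. -/
theorem sum_leading_part_eq_zero {g k : Fin d → ℂ → ℂ} {n : ℕ} (hk : ∀ i, AnalyticAt ℂ (k i) 0)
    (he : ∀ i, ∀ᶠ t in 𝓝 0, g i t = t ^ n * k i t)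
    (hrel : ∀ w, ∀ᶠ z in 𝓝 (0 : ℂ × ℂ), ∑ i, g i (W.f i z) * fderiv ℂ (W.f i) z w = 0)
    (v w : ℂ × ℂ) : ∑ i, k i 0 * fderiv ℂ (W.f i) 0 w * fderiv ℂ (W.f i) 0 v ^ n = 0 := by
  have hv : Tendsto (fun t : ℂ => t • v) (𝓝 0) (𝓝 0) := by
    have h : Continuous fun t : ℂ => t • v := by fun_prop
    simpa using h.tendsto 0
  have hF : ∀ i, Tendsto (W.f i) (𝓝 0) (𝓝 0) := fun i => by
    have h := (W.analyticAt i).continuousAt.tendsto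
    rwa [W.map_zero] at h
  have hlim : Tendsto (fun t : ℂ => ∑ i, k i (W.f i (t • v)) * fderiv ℂ (W.f i) (t • v) w *
      (t⁻¹ * W.f i (t • v)) ^ n) (𝓝[≠] 0)
      (𝓝 (∑ i, k i 0 * fderiv ℂ (W.f i) 0 w * fderiv ℂ (W.f i) 0 v ^ n)) := by
    refine tendsto_finsetSum _ fun i _ => Tendsto.mul (Tendsto.mul ?_ ?_) (Tendsto.pow ?_ n)
    · exact ((hk i).continuousAt.tendsto.comp ((hF i).comp hv)).mono_left nhdsWithin_le_nhds
    · exact ((analyticAt_fderiv_apply (W.analyticAt i) w).continuousAt.tendsto.comp hv).mono_left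
        nhdsWithin_le_nhds
    · have hd : HasDerivAt (fun t : ℂ => W.f i (t • v)) (fderiv ℂ (W.f i) 0 v) 0 := by
        have h1 : HasFDerivAt (W.f i) (fderiv ℂ (W.f i) 0) ((0 : ℂ) • v) := by
          rw [zero_smul]
          exact (W.analyticAt i).differentiableAt.hasFDerivAt
        have h2 : HasDerivAt (fun t : ℂ => t • v) v 0 := by
          simpa using (hasDerivAt_id (0 : ℂ)).smul_const v
        exact h1.comp_hasDerivAt (0 : ℂ) h2
      have h3 := hasDerivAt_iff_tendsto_slope_zero.1 hd
      simpa [W.map_zero] using h3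
  refine tendsto_nhds_unique hlim (Tendsto.congr' ?_ tendsto_const_nhds)
  have hall : ∀ᶠ t : ℂ in 𝓝 0, ∀ i, g i (W.f i (t • v)) = W.f i (t • v) ^ n * k i (W.f i (t • v)) :=
    eventually_all.2 fun i => ((hF i).comp hv).eventually (he i)
  filter_upwards [nhdsWithin_le_nhds hall, nhdsWithin_le_nhds (hv.eventually (hrel w)),
    self_mem_nhdsWithin] with t h1 h2 ht
  rw [← mul_zero (t⁻¹ ^ n), ← h2, Finset.mul_sum]
  refine Finset.sum_congr rfl fun i _ => ?_
  rw [h1, mul_pow]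
  ring

end PlanarWeb

/-- Polarisation of a vanishing sum of powers of linear forms. -/
theorem sum_mul_linear_mul_pow_eq_zero {ι : Type*} [Fintype ι] {L : ι → ℂ × ℂ →L[ℂ] ℂ} {y : ι → ℂ}
    {n : ℕ} (h : ∀ v, ∑ i, y i * L i v ^ (n + 1) = 0) (u v : ℂ × ℂ) :
    ∑ i, y i * L i u * L i v ^ n = 0 := by
  have hd : HasDerivAt (fun s : ℂ => ∑ i, y i * (L i v + s * L i u) ^ (n + 1))
      (∑ i, y i * ((n + 1 : ℕ) * (L i v + 0 * L i u) ^ n * L i u)) 0 := by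
    refine HasDerivAt.fun_sum fun i _ => HasDerivAt.const_mul _ ?_
    have h1 : HasDerivAt (fun s : ℂ => L i v + s * L i u) (L i u) 0 := by
      simpa using ((hasDerivAt_id (0 : ℂ)).mul_const (L i u)).const_add (L i v)
    exact h1.fun_pow (n + 1)
  have hc : (fun s : ℂ => ∑ i, y i * (L i v + s * L i u) ^ (n + 1)) = fun _ => 0 := by
    funext s
    rw [← h (v + s • u)]
    simp
  rw [hc] at hd
  have h0 := hd.unique (hasDerivAt_const (0 : ℂ) (0 : ℂ))
  have hn : ((n + 1 : ℕ) : ℂ) ≠ 0 := Nat.cast_ne_zero.2 n.succ_ne_zero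
  refine (mul_eq_zero.1 ?_).resolve_left hn
  rw [← h0, Finset.mul_sum]
  refine Finset.sum_congr rfl fun i _ => ?_
  ring

/-- A vanishing combination of the powers of four pairwise independent linear forms of degree at
least `3` is trivial; in degree `2` it is trivial as soon as one coefficient vanishes, and in degree
`1` as soon as two of them do. -/
theorem coeff_eq_zero_of_sum_pow_eq_zero {L : Fin 4 → ℂ × ℂ →L[ℂ] ℂ}
    (hL : ∀ i j, i ≠ j → L i (1, 0) * L j (0, 1) - L i (0, 1) * L j (1, 0) ≠ 0) {x : Fin 4 → ℂ}
    {n : ℕ} (hsum : ∀ v w, ∑ i, x i * L i w * L i v ^ n = 0) (hn0 : n = 0 → x 0 = 0 ∧ x 1 = 0)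
    {l : Fin 4} (hn1 : n = 1 → x l = 0) (i : Fin 4) : x i = 0 := by
  let κ : Fin 4 → ℂ × ℂ := fun j => (-L j (0, 1), L j (1, 0))
  have hself : ∀ j, L j (κ j) = 0 := fun j => by
    rw [clm_apply_prod]
    ring
  have hne : ∀ i j, i ≠ j → L i (κ j) ≠ 0 := fun i j hij h => by
    rw [clm_apply_prod] at h
    exact hL i j hij (by linear_combination -h)
  match n, hsum, hn0, hn1 with
  | 0, hsum, hn0, _ =>
    obtain ⟨h0, h1⟩ := hn0 rfl
    have h2 := hsum 0 (κ 3)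
    have h3 := hsum 0 (κ 2)
    simp only [Fin.sum_univ_four, h0, h1, hself, pow_zero, mul_one, zero_mul, mul_zero, zero_add,
      add_zero] at h2 h3
    fin_cases i
    · exact h0
    · exact h1
    · exact (mul_eq_zero.1 h2).resolve_right (hne _ _ (by decide))
    · exact (mul_eq_zero.1 h3).resolve_right (hne _ _ (by decide))
  | 1, hsum, _, hn1 =>
    have hl := hn1 rfl
    by_cases hil : i = l
    · rw [hil, hl]
    have hex : ∀ i l : Fin 4, i ≠ l → ∃ j k : Fin 4, i ≠ j ∧ i ≠ k ∧
        ∀ m, m ≠ i → m ≠ l → m = j ∨ m = k := by decide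
    obtain ⟨j, k, hij, hik, hjk⟩ := hex i l hil
    have h := hsum (κ j) (κ k)
    rw [Finset.sum_eq_single i, pow_one, mul_assoc] at h
    · exact (mul_eq_zero.1 h).resolve_right (mul_ne_zero (hne _ _ hik) (hne _ _ hij))
    · intro m _ hmi
      by_cases hml : m = l
      · rw [hml, hl, zero_mul, zero_mul]
      · rcases hjk m hmi hml with rfl | rfl <;> simp [hself]
    · simp
  | n + 2, hsum, _, _ =>
    obtain ⟨a, b, c, ha, hb, hc, habc⟩ : ∃ a b c : Fin 4, i ≠ a ∧ i ≠ b ∧ i ≠ c ∧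
        ∀ m, m ≠ i → m = a ∨ m = b ∨ m = c := by
      revert i
      decide
    have h := sum_mul_linear_mul_pow_eq_zero (fun v =>
      sum_mul_linear_mul_pow_eq_zero (fun v => hsum v (κ a)) (κ b) v) (κ c) (κ a)
    rw [Finset.sum_eq_single i, mul_assoc, mul_assoc, mul_assoc] at h
    · exact (mul_eq_zero.1 h).resolve_right (mul_ne_zero (hne _ _ ha) (mul_ne_zero (hne _ _ hb)
        (mul_ne_zero (hne _ _ hc) (pow_ne_zero _ (hne _ _ ha)))))
    · intro m _ hmi
      rcases habc m hmi with rfl | rfl | rfl <;> simp [hself]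
    · simp

namespace PlanarWeb

theorem fderiv_comp_f {d : ℕ} (W : PlanarWeb d) {g : ℂ → ℂ} (hg : AnalyticAt ℂ g 0) (i : Fin d)
    (w : ℂ × ℂ) : fderiv ℂ (g ∘ W.f i) 0 w = deriv g 0 * fderiv ℂ (W.f i) 0 w := by
  have h1 : HasDerivAt g (deriv g 0) (W.f i 0) := by
    rw [W.map_zero]
    exact hg.differentiableAt.hasDerivAt
  rw [(h1.comp_hasFDerivAt 0 (W.analyticAt i).differentiableAt.hasFDerivAt).fderiv]
  simp

/-- The differential at `0` of a component of an abelian relation. -/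
theorem exists_derivative_of_mem_abelianRelations {d : ℕ} {W : PlanarWeb d} {h : Fin d → 𝒪}
    (hh : h ∈ W.abelianRelations) (i : Fin d) :
    ∃ γ, evalZero (dX (h i)) = γ * fderiv ℂ (W.f i) 0 (1, 0) ∧
      evalZero (dY (h i)) = γ * fderiv ℂ (W.f i) 0 (0, 1) := by
  obtain ⟨g, hg, he, -⟩ := exists_functions_of_mem_abelianRelations hh
  refine ⟨deriv (g i) 0, ?_, ?_⟩
  · rw [he, dX_toGerm, evalZero_toGerm, fderiv_comp_f W (hg i)]
  · rw [he, dY_toGerm, evalZero_toGerm, fderiv_comp_f W (hg i)]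

theorem leafConstant_of_mem_abelianRelations {d : ℕ} {W : PlanarWeb d} {h : Fin d → 𝒪}
    (hh : h ∈ W.abelianRelations) (i : Fin d) : LeafConstant W i (h i) := by
  obtain ⟨g, hg, he, -⟩ := exists_functions_of_mem_abelianRelations hh
  exact ⟨_, _, (he i).symm, Set.univ, univ_mem, fun z _ z' _ hz => congrArg (g i) hz⟩

/-- An abelian relation of a `4`-web is determined by two of its values and one of its first
derivatives at the origin. -/
theorem eq_zero_of_mem_abelianRelations {W : PlanarWeb 4} {h : Fin 4 → 𝒪}
    (hh : h ∈ W.abelianRelations) (h0 : evalZero (h 0) = 0) (h1 : evalZero (h 1) = 0) {l l' : Fin 4}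
    (hl : l ≠ l')
    (hx : evalZero (dX (h l)) = 0) (hy : evalZero (dY (h l)) = 0) : h = 0 := by
  obtain ⟨g, hg, he, hrel⟩ := exists_functions_of_mem_abelianRelations hh
  by_contra hne
  have hne' : ∃ i, ¬ ∀ᶠ t in 𝓝 0, g i t = 0 := by
    by_contra! hall
    refine hne (funext fun i => ?_)
    have hF : Tendsto (W.f i) (𝓝 0) (𝓝 0) := by
      have h := (W.analyticAt i).continuousAt.tendsto
      rwa [W.map_zero] at h
    rw [he]
    exact toGerm_eq_iff (hg := analyticAt_const).2 (hF.eventually (hall i))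
  obtain ⟨n, k, hk, hgk, i, hi⟩ := exists_leading_part hg hne'
  refine hi (coeff_eq_zero_of_sum_pow_eq_zero (L := fun i => fderiv ℂ (W.f i) 0) W.generalPosition
    (x := fun i => k i 0) (n := n) (l := l) (sum_leading_part_eq_zero hk hgk hrel) ?_ ?_ i)
  · rintro rfl
    have hv : ∀ i, evalZero (h i) = k i 0 := fun i => by
      rw [he, evalZero_toGerm, Function.comp_apply, W.map_zero, (hgk i).self_of_nhds]
      simp
    exact ⟨hv 0 ▸ h0, hv 1 ▸ h1⟩
  · rintro rfl
    have hd : deriv (g l) 0 = k l 0 := by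
      rw [EventuallyEq.deriv_eq (hgk l)]
      have h := (hasDerivAt_id' (0 : ℂ)).fun_mul (hk l).differentiableAt.hasDerivAt
      simpa using h.deriv
    rw [he, dX_toGerm, evalZero_toGerm, fderiv_comp_f W (hg l), hd] at hx
    rw [he, dY_toGerm, evalZero_toGerm, fderiv_comp_f W (hg l), hd] at hy
    by_contra hk0
    refine W.generalPosition l l' hl ?_
    rw [(mul_eq_zero.1 hx).resolve_left hk0, (mul_eq_zero.1 hy).resolve_left hk0]
    ring

end PlanarWeb

namespace PlanarWeb

theorem sum_mul_wedge_eq_zero {d : ℕ} {W : PlanarWeb d} {h : Fin d → 𝒪}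
    (hh : h ∈ W.abelianRelations) (k : Fin d) :
    ∑ j, h j * (dX (W.germ j) * dY (W.germ k) - dY (W.germ j) * dX (W.germ k)) = 0 := by
  obtain ⟨-, h1, h2⟩ := hh
  have e : ∑ j, h j * (dX (W.germ j) * dY (W.germ k) - dY (W.germ j) * dX (W.germ k)) =
      (∑ j, h j * dX (W.germ j)) * dY (W.germ k) - (∑ j, h j * dY (W.germ j)) * dX (W.germ k) := by
    rw [Finset.sum_mul, Finset.sum_mul, ← Finset.sum_sub_distrib]
    exact Finset.sum_congr rfl fun j _ => by ring
  rw [e, h1, h2, zero_mul, zero_mul, sub_zero]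

theorem isUnit_wedge {d : ℕ} (W : PlanarWeb d) {j k : Fin d} (hjk : j ≠ k) :
    IsUnit (dX (W.germ j) * dY (W.germ k) - dY (W.germ j) * dX (W.germ k)) :=
  isUnit_of_evalZero_ne_zero (W.generalPosition j k hjk)

/-- The values at the origin of the first two components of an abelian relation, and a first
derivative of the first one. -/
def initialData (W : PlanarWeb 4) : W.abelianRelations →ₗ[ℂ] Fin 3 → ℂ where
  toFun h := ![evalZero (h.1 0), evalZero (h.1 1),
    fderiv ℂ (W.f 1) 0 (0, 1) * evalZero (dX (h.1 0)) -
      fderiv ℂ (W.f 1) 0 (1, 0) * evalZero (dY (h.1 0))]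
  map_add' h h' := by
    funext a
    fin_cases a
    · simp
    · simp
    · simp
      ring
  map_smul' c h := by
    funext a
    fin_cases a
    · simp [evalZero_smul]
    · simp [evalZero_smul]
    · simp [evalZero_smul]
      ring

theorem initialData_injective (W : PlanarWeb 4) : Function.Injective W.initialData := by
  refine (injective_iff_map_eq_zero _).2 fun h hh => Subtype.ext ?_
  have e0 : evalZero (h.1 0) = 0 := congrFun hh 0
  have e1 : evalZero (h.1 1) = 0 := congrFun hh 1
  have e2 : fderiv ℂ (W.f 1) 0 (0, 1) * evalZero (dX (h.1 0)) -
      fderiv ℂ (W.f 1) 0 (1, 0) * evalZero (dY (h.1 0)) = 0 := congrFun hh 2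
  obtain ⟨γ, hx, hy⟩ := exists_derivative_of_mem_abelianRelations h.2 0
  have hγ : γ = 0 := by
    rw [hx, hy] at e2
    refine (mul_eq_zero.1 ?_).resolve_right (W.generalPosition 0 1 (by decide))
    linear_combination e2
  rw [hγ, zero_mul] at hx hy
  exact eq_zero_of_mem_abelianRelations h.2 e0 e1 (l' := 1) (by decide) hx hy

theorem initialData_surjective {W : PlanarWeb 4} (hW : W.rank = 3) :
    Function.Surjective W.initialData := by
  have hfin : Module.finrank ℂ W.abelianRelations = 3 := hW
  have : FiniteDimensional ℂ W.abelianRelations :=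
    Module.finite_of_finrank_pos (by rw [hfin]; norm_num)
  exact (LinearMap.injective_iff_surjective_of_finrank_eq_finrank (by rw [hfin]; simp)).1
    W.initialData_injective

/-- Webs of maximal rank are linearisable: the points of the dual projective plane defined by a basis
of the abelian relations lie on a line, and this line is the image of the point of the plane. -/
theorem linearisable_of_rank_eq_three {W : PlanarWeb 4} (hW : W.rank = 3) : W.Linearisable := by
  have hex : ∀ v : Fin 3 → ℂ, ∃ h ∈ W.abelianRelations, evalZero (h 0) = v 0 ∧ evalZero (h 1) = v 1 ∧
      (v ≠ 0 → h ≠ 0) := by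
    intro v
    obtain ⟨h, hh⟩ := initialData_surjective hW v
    refine ⟨h.1, h.2, congrFun hh 0, congrFun hh 1, fun hv h0 => hv ?_⟩
    rw [← hh, show h = 0 from Subtype.ext h0, _root_.map_zero]
  obtain ⟨r, hr, r0, r1, -⟩ := hex ![1, 0, 0]
  obtain ⟨s, hs, s0, s1, -⟩ := hex ![0, 1, 0]
  obtain ⟨t, ht, t0, t1, hne⟩ := hex ![0, 0, 1]
  simp only [Matrix.cons_val] at r0 r1 s0 s1 t0 t1
  have ht0 : t ≠ 0 := hne fun h => one_ne_zero (congrFun h 2)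
  have hder : ∀ l l' : Fin 4, l ≠ l' → ∃ γ : ℂ, γ ≠ 0 ∧
      evalZero (dX (t l)) = γ * fderiv ℂ (W.f l) 0 (1, 0) ∧
      evalZero (dY (t l)) = γ * fderiv ℂ (W.f l) 0 (0, 1) := by
    intro l l' hl
    obtain ⟨γ, hx, hy⟩ := exists_derivative_of_mem_abelianRelations ht l
    refine ⟨γ, fun hγ => ht0 ?_, hx, hy⟩
    rw [hγ, zero_mul] at hx hy
    exact eq_zero_of_mem_abelianRelations ht t0 t1 hl hx hy
  obtain ⟨γ₀, hγ₀, x₀, y₀⟩ := hder 0 1 (by decide)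
  obtain ⟨γ₁, hγ₁, x₁, y₁⟩ := hder 1 0 (by decide)
  obtain ⟨m, hm⟩ : ∃ m, (r 0 * s 1 - s 0 * r 1) * m = 1 := by
    refine (isUnit_of_evalZero_ne_zero ?_).exists_right_inv
    simp [r0, s0, r1, s1]
  have hm0 : evalZero m = 1 := by
    simpa [r0, s0, r1, s1] using congrArg evalZero hm
  have hdet : ∀ i, r i * (s 0 * t 1 - t 0 * s 1) + s i * (t 0 * r 1 - r 0 * t 1) +
      t i * (r 0 * s 1 - s 0 * r 1) = 0 := by
    intro i
    match i with
    | 0 => ring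
    | 1 => ring
    | 2 =>
      refine (W.isUnit_wedge (j := 2) (k := 3) (by decide)).mul_right_cancel ?_
      have hr' := sum_mul_wedge_eq_zero hr 3
      have hs' := sum_mul_wedge_eq_zero hs 3
      have ht' := sum_mul_wedge_eq_zero ht 3
      rw [Fin.sum_univ_four] at hr' hs' ht'
      linear_combination (s 0 * t 1 - t 0 * s 1) * hr' + (t 0 * r 1 - r 0 * t 1) * hs' +
        (r 0 * s 1 - s 0 * r 1) * ht'
    | 3 =>
      refine (W.isUnit_wedge (j := 3) (k := 2) (by decide)).mul_right_cancel ?_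
      have hr' := sum_mul_wedge_eq_zero hr 2
      have hs' := sum_mul_wedge_eq_zero hs 2
      have ht' := sum_mul_wedge_eq_zero ht 2
      rw [Fin.sum_univ_four] at hr' hs' ht'
      linear_combination (s 0 * t 1 - t 0 * s 1) * hr' + (t 0 * r 1 - r 0 * t 1) * hs' +
        (r 0 * s 1 - s 0 * r 1) * ht'
  refine linearisable_of_lines (X := (s 0 * t 1 - t 0 * s 1) * m)
    (Y := (t 0 * r 1 - r 0 * t 1) * m) ?_ fun i => ?_
  · have hg := W.generalPosition 0 1 (by decide)
    have e : evalZero (dX ((s 0 * t 1 - t 0 * s 1) * m) * dY ((t 0 * r 1 - r 0 * t 1) * m) -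
        dY ((s 0 * t 1 - t 0 * s 1) * m) * dX ((t 0 * r 1 - r 0 * t 1) * m)) = γ₀ * γ₁ *
        (fderiv ℂ (W.f 0) 0 (1, 0) * fderiv ℂ (W.f 1) 0 (0, 1) -
          fderiv ℂ (W.f 0) 0 (0, 1) * fderiv ℂ (W.f 1) 0 (1, 0)) := by
      simp [r0, s0, t0, r1, s1, t1, hm0, x₀, y₀, x₁, y₁]
      ring
    rw [e]
    exact mul_ne_zero (mul_ne_zero hγ₀ hγ₁) hg
  · refine ⟨r i, s i, t i, leafConstant_of_mem_abelianRelations hr i,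
      leafConstant_of_mem_abelianRelations hs i, leafConstant_of_mem_abelianRelations ht i, ?_, ?_⟩
    · linear_combination m * hdet i - t i * hm
    · have hv : ∀ {j k : Fin 4}, k ≠ 0 → (∀ m, m ≠ 0 → m ≠ 1 → m ≠ k → m = j) →
          evalZero (r j) ≠ 0 := by
        intro j k hk hj h
        refine W.generalPosition 0 k hk.symm ?_
        have e := congrArg evalZero (sum_mul_wedge_eq_zero hr k)
        rw [map_sum, Finset.sum_eq_single 0, map_mul, r0, one_mul, _root_.map_zero] at e
        · exact e
        · intro m _ hm0
          rw [map_mul]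
          by_cases hm1 : m = 1
          · rw [hm1, r1, zero_mul]
          by_cases hmk : m = k
          · rw [hmk, mul_comm (dX _), sub_self, _root_.map_zero, mul_zero]
          · rw [hj m hm0 hm1 hmk, h, zero_mul]
        · simp
      match i with
      | 0 => exact Or.inl (by simp [r0])
      | 1 => exact Or.inr (by simp [s1])
      | 2 => exact Or.inl (hv (k := 3) (by decide) (by decide))
      | 3 => exact Or.inl (hv (k := 2) (by decide) (by decide))

end PlanarWeb

end WebGeometry

end

theorem proposition2 :
    (∀ (W : PlanarWeb 4) (F : Polynomial 𝒪), W.Presents F →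
      ∃ B : Module.Basis (Fin 3) 𝒪 (bundleE (systemM W F)),
        IsAdapted (systemM W F) B ∧
        (∀ u : bundleE (systemM W F), B.equivFun u =
          ![3 * u.1 0 ⟨(1, 0), by norm_num⟩
              + (systemM W F 0 1 + 2 * systemM W F 1 0) * u.1 0 ⟨(0, 0), by norm_num⟩
              + (systemM W F 1 1 - systemM W F 2 0) * u.1 1 ⟨(0, 0), by norm_num⟩,
            u.1 0 ⟨(0, 0), by norm_num⟩,
            -u.1 1 ⟨(0, 0), by norm_num⟩]) ∧
        LinearMap.toMatrix B B (curvature (systemM W F)) =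
          !![3 * kappa (systemM W F),
              3 * dX (kappa (systemM W F)) + condL₁ W.polyP,
              3 * dY (kappa (systemM W F)) + condL₂ W.polyP;
            0, 0, 0;
            0, 0, 0] ∧
        (W.Linearisable ↔ condL₁ W.polyP = 0 ∧ condL₂ W.polyP = 0) ∧
        (W.Linearisable ↔
          LinearMap.toMatrix B B (curvature (systemM W F)) 0 1 = 3 * dX (kappa (systemM W F)) ∧
          LinearMap.toMatrix B B (curvature (systemM W F)) 0 2 = 3 * dY (kappa (systemM W F)))) ∧
    (∀ W : PlanarWeb 4, W.rank = 3 → W.Linearisable) := by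
  refine ⟨fun W F hF => ?_, fun W hW => PlanarWeb.linearisable_of_rank_eq_three hW⟩
  have hY := fun i => hF.isUnit_dY (by norm_num) i
  have hmat := toMatrix_curvature (systemM W F)
  rw [cubicOf_systemM hF] at hmat
  have hlin : W.Linearisable ↔ condL₁ W.polyP = 0 ∧ condL₂ W.polyP = 0 :=
    ⟨condL_eq_zero_of_linearisable hY, fun h => linearisable_of_condL_eq_zero hY h.1 h.2⟩
  refine ⟨adaptedBasis (systemM W F), isAdapted_adaptedBasis _, adaptedBasis_equivFun _, hmat, hlin,
    ?_⟩
  rw [hlin, hmat]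
  exact and_congr add_eq_left.symm add_eq_left.symm
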